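/- Notation. For a finite additive (abelian) group $Z$, an integer $s\ge 1$ and $g\colon Z\to\mathbb{R}$, let $$\|g\|_{U^s(Z)}=\Big(\frac{1}{|Z|^{s+1}}\sum_{x\in Z}\sum_{(h_1,\dots,h_s)\in Z^s}\ \prod_{\omega\in\{0,1\}^s} g\big(x+\omega_1h_1+\cdots+\omega_sh_s\big)\Big)^{1/2^s}$$ denote the Gowers uniformity norm of $g$. Write $[N]=\{1,\dots,N\}$ and $\mathbb{Z}_M=\mathbb{Z}/M\mathbb{Z}$; for $M>2N$ identify $[N]$ with a subset of $\mathbb{Z}_M$ in the obvious way. For $f\colon[N]\to\mathbb{R}$ let $$\|f\|_{U^s[N]}=\frac{\|f\mathbf{1}_{[N]}\|_{U^s(\mathbb{Z}_{M})}}{\|\mathbf{1}_{[N]}\|_{U^s(\mathbb{Z}_{M})}},$$ where $M>2N$ is an integer, $f\mathbf{1}_{[N]}$ is the extension of $f$ by zero and $\mathbf{1}_{[N]}$ is the indicator function of $[N]$; the value does not depend on the choice of $M>2N$. Corollary 5.5. For every integer $s\ge 2$, every real $C\ge 20$ and every $0<\varepsilon\le 1$ there exist a positive integer $N_0$ and a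 real $\eta>0$ with the following property. Let $N\ge N_0$ be an integer and let $N'\in[CN,2CN]$ be a prime. Let $\nu\colon\mathbb{Z}_{N'}\to[0,\infty)$ satisfy $$\|\nu-1\|_{U^{2s}(\mathbb{Z}_{N'})}\le\eta,$$ and let $f\colon[N]\to\mathbb{R}$ satisfy $|f(n)|\le\nu(n)$ for every $n\in[N]$. Then there exists a function $h\colon[N]\to[-1,1]$ such that $$\|f-h\|_{U^s[N]}\le\varepsilon.$$ Moreover, if $f$ is nonnegative, then $h$ can be taken to be nonnegative as well. -/

import Mathlib

open scoped BigOperators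

noncomputable section

/-- The Gowers uniformity norm `‖f‖_{U^s(Z)}` of a real-valued function on a finite additive
group `Z`: the `2^s`-th root of the average of `∏_{ω ∈ {0,1}^s} f (x + ω · h)` over all
`x ∈ Z` and `h ∈ Z^s`, where `ω · h = ∑ i, ω i • h i`. -/
def gowersNorm {Z : Type*} [AddCommGroup Z] [Fintype Z] (s : ℕ) (f : Z → ℝ) : ℝ :=
  (𝔼 p : Z × (Fin s → Z),
    ∏ ω : Fin s → Fin 2, f (p.1 + ∑ i, (ω i : ℕ) • p.2 i)) ^ (1 / (2 : ℝ) ^ s)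

/-- For `f : [N] → ℝ`, where `[N] = {1, …, N}`, the function `f 1_{[N]}` on `ℤ/Mℤ`: it extends
`f` by zero outside `[N]`. For `N < M` the interval `[N]` is identified with the set of residue
classes whose representative in `{0, …, M - 1}` lies in `[N]`. -/
def extendInterval {N : ℕ} (M : ℕ) (f : Finset.Icc 1 N → ℝ) (x : ZMod M) : ℝ :=
  if hx : x.val ∈ Finset.Icc 1 N then f ⟨x.val, hx⟩ else 0

/-- The Gowers uniformity norm `‖f‖_{U^s[N]}` of `f : [N] → ℝ` on the interval `[N]`, computed
in the cyclic group `ℤ/Mℤ`, where `M > 2 * N` (every such `M` gives the same value):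
`‖f 1_{[N]}‖_{U^s(ℤ/Mℤ)} / ‖1_{[N]}‖_{U^s(ℤ/Mℤ)}`. -/
def gowersIntervalNorm {N : ℕ} (M : ℕ) [NeZero M] (s : ℕ) (f : Finset.Icc 1 N → ℝ) : ℝ :=
  gowersNorm s (extendInterval M f) /
    gowersNorm s (extendInterval M (fun _ : Finset.Icc 1 N => (1 : ℝ)))

end

/-!
Call an average `x ↦ 𝔼 h, ∏ ω ≠ 0, F ω (x + ω · h)` of functions `F ω` bounded by `1` a dual
function. A product of two dual functions is an average of dual functions, so their closed convex
hull `K` is closed under multiplication, and the `U^{2s}` norm of `ν - 1` controls its averages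
against `K`. By Weierstrass approximation `ν - 1` is then almost orthogonal to `max φ 0` for every
`φ ∈ K`, and the minimax theorem gives a bounded function `g` such that `f - g` is almost orthogonal
to `K`.

A smoothed indicator function of the interval `[N]` is, up to a bounded factor, a dual function for
`U^2`. As `K` is closed under multiplication, `g` can therefore be cut off to `[N]`.

To bound the `U^s` norm of `f - g`, expand its power as an average over parallelepipeds. By the
Cauchy–Schwarz inequality the unbounded factors can be replaced one at a time by truncated dual
functions (densification). Once all factors but one are bounded, the average is one of `f - g`
against a dual function, which is small.

Finally, `[N]` has the same additive structure in `ℤ/Mℤ` for all `M > 2 * N` (Freiman isomorphism),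
so the norm on `[N]` does not depend on `M`.
-/

theorem update_funSplitAt_symm {ι α : Type*} [DecidableEq ι] (j : ι) (a b : α)
    (η : {i // i ≠ j} → α) :
    Function.update ((Equiv.funSplitAt j α).symm (a, η)) j b =
      (Equiv.funSplitAt j α).symm (b, η) := by
  funext i
  by_cases hi : i = j
  · subst hi; simp
  · simp [hi]

section Cubes

variable {ι κ Z : Type*} [Fintype ι] [Fintype κ] [AddCommGroup Z]

/-- The vertex `x + ω · h` of the parallelepiped in `Z` with base point `x` and edges `h`. -/
def cubeVertex (x : Z) (h : ι → Z) (ω : ι → Fin 2) : Z :=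
  x + ∑ i, (ω i : ℕ) • h i

@[simp]
theorem cubeVertex_zero (x : Z) (h : ι → Z) : cubeVertex x h 0 = x := by
  simp [cubeVertex]

theorem cubeVertex_cubeVertex (x : Z) (h k : ι → Z) (ω : ι → Fin 2) :
    cubeVertex (cubeVertex x h ω) k ω = cubeVertex x (h + k) ω := by
  simp only [cubeVertex, Pi.add_apply, smul_add, Finset.sum_add_distrib, add_assoc]

theorem cubeVertex_comp_equiv (e : ι ≃ κ) (x : Z) (h : κ → Z) (ω : κ → Fin 2) :
    cubeVertex x (h ∘ e) (ω ∘ e) = cubeVertex x h ω :=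
  congrArg (x + ·) (e.sum_comp fun i => (ω i : ℕ) • h i)

theorem cubeVertex_sumElim (x : Z) (h : ι → Z) (k : κ → Z) (ω : ι → Fin 2) (η : κ → Fin 2) :
    cubeVertex x (Sum.elim h k) (Sum.elim ω η) = cubeVertex (cubeVertex x h ω) k η := by
  simp [cubeVertex, add_assoc]

theorem cubeVertex_funSplitAt_symm [DecidableEq ι] (j : ι) (x t : Z) (h : {i // i ≠ j} → Z)
    (b : Fin 2) (η : {i // i ≠ j} → Fin 2) :
    cubeVertex x ((Equiv.funSplitAt j Z).symm (t, h)) ((Equiv.funSplitAt j (Fin 2)).symm (b, η)) =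
      cubeVertex (x + (b : ℕ) • t) h η := by
  rw [cubeVertex, Fintype.sum_eq_add_sum_subtype_ne _ j, ← add_assoc]
  refine congrArg₂ (· + ·) (by simp) (Finset.sum_congr rfl fun i _ => ?_)
  simp [i.2]

theorem cubeVertex_reflect (x : Z) (h : ι → Z) (τ ω : ι → Fin 2) :
    cubeVertex (cubeVertex x h τ) (fun i => if τ i = 0 then h i else -h i) ω =
      cubeVertex x h (ω + τ) := by
  simp only [cubeVertex, add_assoc, ← Finset.sum_add_distrib]
  refine congrArg (x + ·) (Finset.sum_congr rfl fun i _ => ?_)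
  have fin_two : ∀ b : Fin 2, b = 0 ∨ b = 1 := by decide
  rcases fin_two (ω i) with hω | hω <;> rcases fin_two (τ i) with hτ | hτ <;> simp [hω, hτ]

variable [Fintype Z] [DecidableEq ι] [DecidableEq κ]

/-- The average of `∏ ω, F ω (x + ω · h)` over all parallelepipeds `(x, h)` in `Z`: the Gowers
inner product of the system of functions `F`. -/
noncomputable def cubeAvg (F : (ι → Fin 2) → Z → ℝ) : ℝ :=
  𝔼 x : Z, 𝔼 h : ι → Z, ∏ ω, F ω (cubeVertex x h ω)

theorem cubeAvg_eq_expect_prod (F : (ι → Fin 2) → Z → ℝ) :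
    cubeAvg F = 𝔼 p : Z × (ι → Z), ∏ ω, F ω (cubeVertex p.1 p.2 ω) := by
  rw [← Finset.univ_product_univ, Finset.expect_product]
  rfl

theorem cubeAvg_comp_equiv (e : ι ≃ κ) (F : (ι → Fin 2) → Z → ℝ) :
    cubeAvg (fun ω : κ → Fin 2 => F (ω ∘ e)) = cubeAvg F := by
  refine Finset.expect_congr rfl fun x _ =>
    Fintype.expect_equiv (e.symm.arrowCongr (Equiv.refl Z)) _ _ fun h =>
      Fintype.prod_equiv (e.symm.arrowCongr (Equiv.refl (Fin 2))) _ _ fun ω => ?_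
  exact congrArg (F (ω ∘ e)) (cubeVertex_comp_equiv e x h ω).symm

theorem cubeAvg_reflect (τ : ι → Fin 2) (F : (ι → Fin 2) → Z → ℝ) :
    cubeAvg (fun ω => F (ω + τ)) = cubeAvg F := by
  let R : Z × (ι → Z) → Z × (ι → Z) := fun p =>
    (cubeVertex p.1 p.2 τ, fun i => if τ i = 0 then p.2 i else -p.2 i)
  have two_torsion : ∀ b : Fin 2, b + b = 0 := by decide
  have hττ : τ + τ = 0 := funext fun i => two_torsion (τ i)
  have hR : Function.Involutive R := by
    rintro ⟨x, h⟩
    refine Prod.ext (by simp [R, cubeVertex_reflect, hττ]) (funext fun i => ?_)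
    by_cases hi : τ i = 0 <;> simp [R, hi]
  rw [cubeAvg_eq_expect_prod, cubeAvg_eq_expect_prod]
  refine Fintype.expect_equiv hR.toPerm _ _ fun p =>
    Fintype.prod_equiv (Equiv.addRight τ) _ _ fun ω => congrArg (F (ω + τ)) ?_
  refine Eq.trans ?_ (cubeVertex_reflect p.1 p.2 τ (ω + τ)).symm
  rw [add_assoc, hττ, add_zero]

theorem abs_cubeAvg_le {F V : (ι → Fin 2) → Z → ℝ} (hFV : ∀ ω x, |F ω x| ≤ V ω x) :
    |cubeAvg F| ≤ cubeAvg V := by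
  refine (Finset.abs_expect_le _ _).trans <| Finset.expect_le_expect fun x _ =>
    (Finset.abs_expect_le _ _).trans <| Finset.expect_le_expect fun h _ => ?_
  rw [Finset.abs_prod]
  exact Finset.prod_le_prod (fun _ _ => abs_nonneg _) fun ω _ => hFV ω _

/-- The product over the face `ω j = b` of the cube, with base point `x` and edges `h` parallel
to that face. -/
noncomputable def faceProd (F : (ι → Fin 2) → Z → ℝ) (j : ι) (b : Fin 2) (h : {i // i ≠ j} → Z)
    (x : Z) : ℝ :=
  ∏ η : {i // i ≠ j} → Fin 2, F ((Equiv.funSplitAt j (Fin 2)).symm (b, η)) (cubeVertex x h η)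

theorem cubeAvg_eq_expect_faceProd (F : (ι → Fin 2) → Z → ℝ) (j : ι) :
    cubeAvg F = 𝔼 h : {i // i ≠ j} → Z, (𝔼 x, faceProd F j 0 h x) * 𝔼 x, faceProd F j 1 h x := by
  have split_prod (x t : Z) (h : {i // i ≠ j} → Z) :
      ∏ ω, F ω (cubeVertex x ((Equiv.funSplitAt j Z).symm (t, h)) ω) =
        faceProd F j 0 h x * faceProd F j 1 h (x + t) := by
    rw [← (Equiv.funSplitAt j (Fin 2)).symm.prod_comp, Fintype.prod_prod_type, Fin.prod_univ_two]
    simp only [cubeVertex_funSplitAt_symm, Fin.val_zero, Fin.val_one, zero_smul, one_smul, add_zero,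
      faceProd]
  calc cubeAvg F
      = 𝔼 x, 𝔼 t, 𝔼 h, faceProd F j 0 h x * faceProd F j 1 h (x + t) := by
        refine Finset.expect_congr rfl fun x _ => ?_
        simp only [← split_prod]
        rw [← Finset.expect_product' (s := Finset.univ) (t := Finset.univ)
          (f := fun t h => ∏ ω, F ω (cubeVertex x ((Equiv.funSplitAt j Z).symm (t, h)) ω)),
          Finset.univ_product_univ]
        exact Fintype.expect_equiv (Equiv.funSplitAt j Z) _ _ fun h => by
          rw [Prod.mk.eta, Equiv.symm_apply_apply]
    _ = 𝔼 h, 𝔼 x, 𝔼 t, faceProd F j 0 h x * faceProd F j 1 h (x + t) := by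
        exact (Finset.expect_congr rfl fun x _ => Finset.expect_comm _ _ _).trans
          (Finset.expect_comm _ _ _)
    _ = _ := by
        refine Finset.expect_congr rfl fun h _ => ?_
        rw [Finset.expect_mul]
        refine Finset.expect_congr rfl fun x _ => ?_
        rw [← Finset.mul_expect]
        exact congrArg _ (Fintype.expect_equiv (Equiv.addLeft x) _ _ fun t => rfl)

theorem cubeAvg_update_apply (F : (ι → Fin 2) → Z → ℝ) (j : ι) (b : Fin 2) :
    cubeAvg (fun ω => F (Function.update ω j b)) =
      𝔼 h : {i // i ≠ j} → Z, (𝔼 x, faceProd F j b h x) ^ 2 := by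
  rw [cubeAvg_eq_expect_faceProd _ j]
  simp only [faceProd, update_funSplitAt_symm, sq]

theorem cubeAvg_const_nonneg [Nonempty ι] (f : Z → ℝ) : 0 ≤ cubeAvg fun _ : ι → Fin 2 => f := by
  rw [cubeAvg_update_apply (fun _ => f) (Classical.arbitrary ι) 0]
  exact Finset.expect_nonneg fun _ _ => sq_nonneg _

theorem cubeAvg_sq_le (F : (ι → Fin 2) → Z → ℝ) (j : ι) :
    cubeAvg F ^ 2 ≤ cubeAvg (fun ω => F (Function.update ω j 0)) *
      cubeAvg (fun ω => F (Function.update ω j 1)) := by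
  rw [cubeAvg_update_apply, cubeAvg_update_apply, cubeAvg_eq_expect_faceProd F j]
  exact Finset.expect_mul_sq_le_sq_mul_sq _ _ _

end Cubes

section CubeNorm

variable {ι κ Z : Type*} [Fintype ι] [DecidableEq ι] [Fintype κ] [DecidableEq κ]
  [AddCommGroup Z] [Fintype Z]

variable (ι) in
/-- The Gowers norm `‖f‖_{U^ι(Z)}` whose cube directions are indexed by an arbitrary finite type
`ι`, so that doubled cubes are cubes indexed by `ι ⊕ ι`. -/
noncomputable def cubeNorm (f : Z → ℝ) : ℝ :=
  cubeAvg (fun _ : ι → Fin 2 => f) ^ (1 / (2 : ℝ) ^ Fintype.card ι)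

theorem gowersNorm_eq_cubeNorm (s : ℕ) (f : Z → ℝ) : gowersNorm s f = cubeNorm (Fin s) f := by
  rw [cubeNorm, cubeAvg_eq_expect_prod, Fintype.card_fin]
  rfl

theorem cubeNorm_congr (e : ι ≃ κ) (f : Z → ℝ) : cubeNorm ι f = cubeNorm κ f := by
  rw [cubeNorm, cubeNorm, Fintype.card_congr e, ← cubeAvg_comp_equiv e]

theorem prod_update_zero_mul_update_one {M : Type*} [CommMonoid M] (c : (ι → Fin 2) → M) (j : ι) :
    ∏ b, c (Function.update b j 0) * c (Function.update b j 1) = (∏ b, c b) ^ 2 := by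
  simp only [← (Equiv.funSplitAt j (Fin 2)).symm.prod_comp, Fintype.prod_prod_type_right,
    Fin.prod_univ_two, update_funSplitAt_symm, ← sq, Finset.prod_pow]

@[simp]
theorem cubeNorm_one : cubeNorm ι (1 : Z → ℝ) = 1 := by
  simp [cubeNorm, cubeAvg]

@[simp]
theorem cubeNorm_zero : cubeNorm ι (0 : Z → ℝ) = 0 := by
  simp [cubeNorm, cubeAvg]

/-- Applies the Cauchy–Schwarz inequality in one direction after another, making the system
independent of those coordinates of the vertex that lie in `S`. -/
theorem abs_cubeAvg_pow_le_prod_piecewise (F : (ι → Fin 2) → Z → ℝ) (S : Finset ι) :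
    |cubeAvg F| ^ 2 ^ Fintype.card ι ≤
      ∏ b : ι → Fin 2, |cubeAvg fun ω => F (S.piecewise b ω)| := by
  induction S using Finset.induction_on with
  | empty => simp
  | insert j S hj ih =>
    refine ih.trans ?_
    have piecewise_update (b : ι → Fin 2) (d : Fin 2) (ω : ι → Fin 2) :
        S.piecewise b (Function.update ω j d) =
          (insert j S).piecewise (Function.update b j d) ω := by
      funext i
      by_cases hi : i = j
      · subst hi; simp [Finset.piecewise, hj]
      · simp [Finset.piecewise, hi]
    have cauchy_schwarz (b : ι → Fin 2) :
        |cubeAvg fun ω => F (S.piecewise b ω)| ^ 2 ≤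
          |cubeAvg fun ω => F ((insert j S).piecewise (Function.update b j 0) ω)| *
            |cubeAvg fun ω => F ((insert j S).piecewise (Function.update b j 1) ω)| := by
      rw [sq_abs, ← abs_mul]
      simp only [← piecewise_update]
      exact (cubeAvg_sq_le (fun ω => F (S.piecewise b ω)) j).trans (le_abs_self _)
    refine le_of_sq_le_sq ?_ (Finset.prod_nonneg fun _ _ => abs_nonneg _)
    rw [← Finset.prod_pow, ← prod_update_zero_mul_update_one _ j]
    exact Finset.prod_le_prod (fun _ _ => sq_nonneg _) fun b _ => cauchy_schwarz b

theorem prod_add_eq_sum_prod_piecewise {α R : Type*} [Fintype α] [DecidableEq α] [CommSemiring R]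
    (f g : α → R) : ∏ a, (f a + g a) = ∑ S : Finset α, ∏ a, S.piecewise f g a := by
  simp only [Fintype.prod_add, Finset.prod_piecewise, Finset.univ_inter,
    ← Finset.compl_eq_univ_sdiff]

theorem cubeAvg_add (F G : (ι → Fin 2) → Z → ℝ) :
    cubeAvg (F + G) = ∑ S : Finset (ι → Fin 2), cubeAvg (S.piecewise F G) := by
  simp only [cubeAvg, ← Finset.expect_sum_comm]
  refine Finset.expect_congr rfl fun x _ => Finset.expect_congr rfl fun h _ => ?_
  simp only [Pi.add_apply, prod_add_eq_sum_prod_piecewise]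
  refine Finset.sum_congr rfl fun S _ => Finset.prod_congr rfl fun ω _ => ?_
  by_cases hω : ω ∈ S <;> simp [hω]

variable [Nonempty ι]

theorem cubeNorm_nonneg (f : Z → ℝ) : 0 ≤ cubeNorm ι f :=
  Real.rpow_nonneg (cubeAvg_const_nonneg f) _

theorem cubeNorm_pow (f : Z → ℝ) :
    cubeNorm ι f ^ 2 ^ Fintype.card ι = cubeAvg fun _ : ι → Fin 2 => f := by
  rw [cubeNorm, ← Real.rpow_natCast, ← Real.rpow_mul (cubeAvg_const_nonneg f)]
  simp

/-- The Gowers–Cauchy–Schwarz inequality. -/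
theorem abs_cubeAvg_le_prod_cubeNorm (F : (ι → Fin 2) → Z → ℝ) :
    |cubeAvg F| ≤ ∏ ω, cubeNorm ι (F ω) := by
  refine le_of_pow_le_pow_left₀ (n := 2 ^ Fintype.card ι) (by positivity)
    (Finset.prod_nonneg fun _ _ => cubeNorm_nonneg _) ?_
  simpa only [Finset.piecewise_univ, abs_of_nonneg (cubeAvg_const_nonneg _), ← Finset.prod_pow,
    cubeNorm_pow] using abs_cubeAvg_pow_le_prod_piecewise F Finset.univ

theorem cubeNorm_le_of_cubeAvg_le {f : Z → ℝ} {B : ℝ} (hB : 0 ≤ B)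
    (h : cubeAvg (fun _ : ι → Fin 2 => f) ≤ B ^ 2 ^ Fintype.card ι) : cubeNorm ι f ≤ B :=
  le_of_pow_le_pow_left₀ (by positivity) hB ((cubeNorm_pow f).trans_le h)

theorem cubeNorm_mono {f g : Z → ℝ} (hfg : ∀ x, |f x| ≤ g x) : cubeNorm ι f ≤ cubeNorm ι g :=
  cubeNorm_le_of_cubeAvg_le (cubeNorm_nonneg g) <| (cubeNorm_pow (ι := ι) g).symm ▸
    (le_abs_self _).trans (abs_cubeAvg_le fun _ => hfg)

theorem cubeNorm_smul (c : ℝ) (f : Z → ℝ) : cubeNorm ι (c • f) = |c| * cubeNorm ι f := by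
  have even_card : Even (2 ^ Fintype.card ι) := (Nat.even_pow' Fintype.card_ne_zero).2 even_two
  refine (pow_left_inj₀ (n := 2 ^ Fintype.card ι) (cubeNorm_nonneg _)
    (mul_nonneg (abs_nonneg c) (cubeNorm_nonneg f)) (by positivity)).1 ?_
  rw [mul_pow, even_card.pow_abs, cubeNorm_pow, cubeNorm_pow]
  simp [cubeAvg, Finset.prod_mul_distrib, Finset.mul_expect]

theorem abs_cubeAvg_add_sub_le (F G : (ι → Fin 2) → Z → ℝ) :
    |cubeAvg (F + G) - cubeAvg G| ≤
      ∏ ω, (cubeNorm ι (F ω) + cubeNorm ι (G ω)) - ∏ ω, cubeNorm ι (G ω) := by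
  rw [cubeAvg_add, prod_add_eq_sum_prod_piecewise,
    ← Finset.add_sum_erase _ _ (Finset.mem_univ ∅), ← Finset.add_sum_erase _ _ (Finset.mem_univ ∅)]
  simp only [Finset.piecewise_empty, add_sub_cancel_left]
  refine (Finset.abs_sum_le_sum_abs _ _).trans (Finset.sum_le_sum fun S _ => ?_)
  refine (abs_cubeAvg_le_prod_cubeNorm _).trans_eq (Finset.prod_congr rfl fun ω _ => ?_)
  by_cases hω : ω ∈ S <;> simp [hω]

theorem cubeNorm_add_le (f g : Z → ℝ) : cubeNorm ι (f + g) ≤ cubeNorm ι f + cubeNorm ι g := by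
  have hf := cubeNorm_nonneg (ι := ι) f
  have hg := cubeNorm_nonneg (ι := ι) g
  refine cubeNorm_le_of_cubeAvg_le (add_nonneg hf hg) ?_
  have h := abs_cubeAvg_add_sub_le (fun _ : ι → Fin 2 => f) fun _ => g
  simp only [Finset.prod_const, Finset.card_univ, Fintype.card_fun, Fintype.card_fin,
    cubeNorm_pow] at h
  exact sub_le_sub_iff_right _ |>.1 (le_of_abs_le h)

end CubeNorm

section DualFunctions

theorem prod_compl_singleton_eq_prod_ite {α M : Type*} [Fintype α] [DecidableEq α] [CommMonoid M]
    (a : α) (f : α → M) : ∏ b ∈ {a}ᶜ, f b = ∏ b, if b = a then 1 else f b := by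
  rw [Fintype.prod_eq_mul_prod_compl a, if_pos rfl, one_mul]
  exact Finset.prod_congr rfl fun b hb => (if_neg (by simpa using hb)).symm

/-- The system on a product of two cubes with `F` and `G` on the two coordinate faces through the
origin and with `1` at all other vertices. -/
def glue {ι κ α : Type*} [Fintype ι] [Fintype κ] [One α] (F : (ι → Fin 2) → α)
    (G : (κ → Fin 2) → α) (ω : ι ⊕ κ → Fin 2) : α :=
  if ω ∘ Sum.inr = 0 then F (ω ∘ Sum.inl) else if ω ∘ Sum.inl = 0 then G (ω ∘ Sum.inr) else 1

theorem forall_glue {ι κ α : Type*} [Fintype ι] [Fintype κ] [One α] {P : α → Prop}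
    {F : (ι → Fin 2) → α} {G : (κ → Fin 2) → α} (h1 : P 1) (hF : ∀ ω, P (F ω)) (hG : ∀ ω, P (G ω))
    (ω : ι ⊕ κ → Fin 2) : P (glue F G ω) := by
  unfold glue
  split_ifs <;> [exact hF _; exact hG _; exact h1]

variable {ι κ Z : Type*} [Fintype ι] [DecidableEq ι] [Fintype κ] [DecidableEq κ] [AddCommGroup Z]

theorem prod_glue_sumElim (F : (ι → Fin 2) → Z → ℝ) (G : (κ → Fin 2) → Z → ℝ) (x : Z) (h : ι → Z)
    (k : κ → Z) :
    ∏ ω ∈ {0}ᶜ, glue F G ω (cubeVertex x (Sum.elim h k) ω) =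
      (∏ ω ∈ {0}ᶜ, F ω (cubeVertex x h ω)) * ∏ ω ∈ {0}ᶜ, G ω (cubeVertex x k ω) := by
  have glue_sumElim (α : ι → Fin 2) (β : κ → Fin 2) :
      (if Sum.elim α β = 0 then 1 else
        glue F G (Sum.elim α β) (cubeVertex x (Sum.elim h k) (Sum.elim α β))) =
      (if β = 0 then if α = 0 then 1 else F α (cubeVertex x h α) else 1) *
        if α = 0 then if β = 0 then 1 else G β (cubeVertex x k β) else 1 := by
    have sumElim_eq_zero : Sum.elim α β = 0 ↔ α = 0 ∧ β = 0 := by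
      simp only [funext_iff, Sum.forall, Sum.elim_inl, Sum.elim_inr, Pi.zero_apply]
    simp only [glue, sumElim_eq_zero, Sum.elim_comp_inl, Sum.elim_comp_inr, cubeVertex_sumElim]
    by_cases hα : α = 0 <;> by_cases hβ : β = 0 <;> simp [hα, hβ]
  simp only [prod_compl_singleton_eq_prod_ite]
  rw [← (Equiv.sumArrowEquivProdArrow ι κ (Fin 2)).symm.prod_comp, Fintype.prod_prod_type]
  refine (Fintype.prod_congr _ _ fun α => Fintype.prod_congr _ _ (glue_sumElim α)).trans ?_
  simp only [Finset.prod_mul_distrib]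
  congr 1
  · simp
  · rw [Finset.prod_comm]; simp

variable [Fintype Z]

/-- The dual function `x ↦ 𝔼 h, ∏ ω ≠ 0, F ω (x + ω · h)`. -/
noncomputable def dualFun (F : (ι → Fin 2) → Z → ℝ) (x : Z) : ℝ :=
  𝔼 h : ι → Z, ∏ ω ∈ {0}ᶜ, F ω (cubeVertex x h ω)

theorem cubeAvg_update (F : (ι → Fin 2) → Z → ℝ) (τ : ι → Fin 2) (a : Z → ℝ) :
    cubeAvg (Function.update F τ a) = 𝔼 x, a x * dualFun (fun ω => F (ω + τ)) x := by
  rw [← cubeAvg_reflect τ]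
  refine Finset.expect_congr rfl fun x _ => ?_
  rw [dualFun, Finset.mul_expect]
  refine Finset.expect_congr rfl fun h _ => ?_
  simp only [Fintype.prod_eq_mul_prod_compl (0 : ι → Fin 2), cubeVertex_zero, zero_add,
    Function.update_self]
  refine congrArg _ (Finset.prod_congr rfl fun ω hω => ?_)
  rw [Function.update_of_ne (by simpa using hω)]

theorem cubeAvg_eq_expect_mul_dualFun (F : (ι → Fin 2) → Z → ℝ) (τ : ι → Fin 2) :
    cubeAvg F = 𝔼 x, F τ x * dualFun (fun ω => F (ω + τ)) x := by
  rw [← cubeAvg_update, Function.update_eq_self]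

theorem abs_dualFun_le {F V : (ι → Fin 2) → Z → ℝ} (hFV : ∀ ω ≠ 0, ∀ x, |F ω x| ≤ V ω x) (x : Z) :
    |dualFun F x| ≤ dualFun V x := by
  refine (Finset.abs_expect_le _ _).trans (Finset.expect_le_expect fun h _ => ?_)
  rw [Finset.abs_prod]
  exact Finset.prod_le_prod (fun _ _ => abs_nonneg _) fun ω hω => hFV ω (by simpa using hω) _

@[simp]
theorem dualFun_one : dualFun (1 : (ι → Fin 2) → Z → ℝ) = 1 := by
  funext x
  simp [dualFun]

theorem abs_dualFun_le_one {F : (ι → Fin 2) → Z → ℝ} (hF : ∀ ω ≠ 0, ∀ x, |F ω x| ≤ 1) (x : Z) :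
    |dualFun F x| ≤ 1 := by
  simpa using abs_dualFun_le (V := 1) hF x

theorem abs_expect_mul_dualFun_le [Nonempty ι] {F : (ι → Fin 2) → Z → ℝ}
    (hF : ∀ ω ≠ 0, ∀ x, |F ω x| ≤ 1) (a : Z → ℝ) : |𝔼 x, a x * dualFun F x| ≤ cubeNorm ι a := by
  have h := abs_cubeAvg_le_prod_cubeNorm (Function.update F 0 a)
  rw [cubeAvg_update, Fintype.prod_eq_mul_prod_compl 0, Function.update_self] at h
  simp only [add_zero] at h
  refine h.trans (mul_le_of_le_one_right (cubeNorm_nonneg a)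
    (Finset.prod_le_one (fun _ _ => cubeNorm_nonneg _) fun ω hω => ?_))
  have hω : ω ≠ 0 := by simpa using hω
  rw [Function.update_of_ne hω, ← cubeNorm_one (ι := ι) (Z := Z)]
  exact cubeNorm_mono (hF ω hω)

theorem abs_expect_le_cubeNorm [Nonempty ι] (f : Z → ℝ) : |𝔼 x, f x| ≤ cubeNorm ι f := by
  simpa using abs_expect_mul_dualFun_le (F := (1 : (ι → Fin 2) → Z → ℝ)) (by simp) f

theorem dualFun_glue (F : (ι → Fin 2) → Z → ℝ) (G : (κ → Fin 2) → Z → ℝ) :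
    dualFun (glue F G) = dualFun F * dualFun G := by
  funext x
  rw [Pi.mul_apply, dualFun, dualFun, dualFun, Finset.expect_mul_expect]
  simp only [← prod_glue_sumElim]
  rw [← Finset.expect_product' (s := Finset.univ) (t := Finset.univ)
    (f := fun h k => ∏ ω ∈ {0}ᶜ, glue F G ω (cubeVertex x (Sum.elim h k) ω)),
    Finset.univ_product_univ]
  refine Fintype.expect_equiv (Equiv.sumArrowEquivProdArrow ι κ Z) _ _ fun h => ?_
  exact congrArg (fun k => ∏ ω ∈ {0}ᶜ, glue F G ω (cubeVertex x k ω)) (Sum.elim_comp_inl_inr h).symm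

theorem expect_mul_dualFun_mul_dualFun (a : Z → ℝ) (F G : (ι → Fin 2) → Z → ℝ) :
    𝔼 x, a x * (dualFun F x * dualFun G x) = cubeAvg (Function.update (glue F G) 0 a) := by
  simp only [cubeAvg_update, add_zero, dualFun_glue, Pi.mul_apply]

end DualFunctions

section Pseudorandom

variable {κ Z : Type*} [Fintype κ] [DecidableEq κ] [Nonempty κ] [AddCommGroup Z] [Fintype Z]

theorem one_add_pow_sub_one_le {τ : ℝ} (h0 : 0 ≤ τ) (h1 : τ ≤ 1) (n : ℕ) :
    (1 + τ) ^ n - 1 ≤ 2 ^ n * τ := by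
  have h := (convexOn_pow n).2 (Set.mem_Ici.2 zero_le_one) (Set.mem_Ici.2 zero_le_two)
    (sub_nonneg.2 h1) h0 (sub_add_cancel 1 τ)
  simp only [smul_eq_mul, one_pow, mul_one] at h
  rw [show 1 - τ + τ * 2 = 1 + τ by ring] at h
  linarith

/-- The linear forms condition of Green and Tao. -/
theorem abs_cubeAvg_sub_one_le {V : (κ → Fin 2) → Z → ℝ} {τ : ℝ} (hτ : τ ≤ 1)
    (hV : ∀ ω, cubeNorm κ (V ω - 1) ≤ τ) :
    |cubeAvg V - 1| ≤ 2 ^ 2 ^ Fintype.card κ * τ := by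
  have hτ0 : 0 ≤ τ := (cubeNorm_nonneg _).trans (hV 0)
  have h := abs_cubeAvg_add_sub_le (fun ω => V ω - 1) 1
  simp only [Pi.one_apply, cubeNorm_one, Finset.prod_const_one] at h
  calc |cubeAvg V - 1|
      = |cubeAvg ((fun ω => V ω - 1) + 1) - cubeAvg (1 : (κ → Fin 2) → Z → ℝ)| := by
        congr 2
        · exact congrArg cubeAvg (funext fun ω => (sub_add_cancel (V ω) 1).symm)
        · simp [cubeAvg]
    _ ≤ ∏ ω, (cubeNorm κ (V ω - 1) + 1) - 1 := h
    _ ≤ (1 + τ) ^ 2 ^ Fintype.card κ - 1 := by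
        refine sub_le_sub_right ((Finset.prod_le_prod (g := fun _ => 1 + τ) (fun ω _ => ?_)
          fun ω _ => ?_).trans_eq ?_) 1
        · exact add_nonneg (cubeNorm_nonneg _) zero_le_one
        · linarith [hV ω]
        · simp
    _ ≤ 2 ^ 2 ^ Fintype.card κ * τ := one_add_pow_sub_one_le hτ0 hτ _

theorem cubeNorm_le_two {f v : Z → ℝ} (hfv : ∀ x, |f x| ≤ v x) (hv : cubeNorm κ (v - 1) ≤ 1) :
    cubeNorm κ f ≤ 2 :=
  calc cubeNorm κ f ≤ cubeNorm κ (v - 1 + 1) := cubeNorm_mono (by simpa using hfv)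
    _ ≤ cubeNorm κ (v - 1) + cubeNorm κ 1 := cubeNorm_add_le _ _
    _ ≤ 2 := by rw [cubeNorm_one]; linarith

theorem abs_cubeAvg_le_of_cubeNorm_le {F : (κ → Fin 2) → Z → ℝ} {τ : ℝ} (ω₀ : κ → Fin 2)
    (h₀ : cubeNorm κ (F ω₀) ≤ τ) (hF : ∀ ω ≠ ω₀, cubeNorm κ (F ω) ≤ 2) :
    |cubeAvg F| ≤ 2 ^ 2 ^ Fintype.card κ * τ := by
  have hτ : 0 ≤ τ := (cubeNorm_nonneg _).trans h₀
  calc |cubeAvg F| ≤ ∏ ω, cubeNorm κ (F ω) := abs_cubeAvg_le_prod_cubeNorm F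
    _ = cubeNorm κ (F ω₀) * ∏ ω ∈ {ω₀}ᶜ, cubeNorm κ (F ω) := Fintype.prod_eq_mul_prod_compl _ _
    _ ≤ τ * 2 ^ 2 ^ Fintype.card κ := by
        refine mul_le_mul h₀ ?_ (Finset.prod_nonneg fun _ _ => cubeNorm_nonneg _) hτ
        refine (Finset.prod_le_prod (fun _ _ => cubeNorm_nonneg _) fun ω hω =>
          hF ω (by simpa using hω)).trans ?_
        rw [Finset.prod_const]
        exact pow_le_pow_right₀ one_le_two ((Finset.card_le_univ _).trans_eq (by simp))
    _ = 2 ^ 2 ^ Fintype.card κ * τ := mul_comm _ _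

variable {ι : Type*} [Fintype ι] [DecidableEq ι] [Nonempty ι]

theorem abs_expect_mul_dualFun_mul_dualFun_sub_one_le {a : Z → ℝ} {V W : (ι → Fin 2) → Z → ℝ}
    {τ : ℝ} (hτ : τ ≤ 1) (ha : cubeNorm (ι ⊕ ι) (a - 1) ≤ τ)
    (hV : ∀ ω, cubeNorm (ι ⊕ ι) (V ω - 1) ≤ τ) (hW : ∀ ω, cubeNorm (ι ⊕ ι) (W ω - 1) ≤ τ) :
    |(𝔼 x, a x * (dualFun V x * dualFun W x)) - 1| ≤ 2 ^ 2 ^ Fintype.card (ι ⊕ ι) * τ := by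
  rw [expect_mul_dualFun_mul_dualFun]
  refine abs_cubeAvg_sub_one_le hτ fun ω => ?_
  by_cases hω : ω = 0
  · simpa [hω] using ha
  · rw [Function.update_of_ne hω]
    refine forall_glue (P := fun v => cubeNorm (ι ⊕ ι) (v - 1) ≤ τ) ?_ hV hW ω
    simpa using (cubeNorm_nonneg (a - 1)).trans ha

theorem abs_expect_mul_dualFun_mul_dualFun_le {a : Z → ℝ} {F G : (ι → Fin 2) → Z → ℝ} {τ : ℝ}
    (ha : cubeNorm (ι ⊕ ι) a ≤ τ) (hF : ∀ ω, cubeNorm (ι ⊕ ι) (F ω) ≤ 2)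
    (hG : ∀ ω, cubeNorm (ι ⊕ ι) (G ω) ≤ 2) :
    |𝔼 x, a x * (dualFun F x * dualFun G x)| ≤ 2 ^ 2 ^ Fintype.card (ι ⊕ ι) * τ := by
  rw [expect_mul_dualFun_mul_dualFun]
  refine abs_cubeAvg_le_of_cubeNorm_le 0 (by simpa using ha) fun ω hω => ?_
  rw [Function.update_of_ne hω]
  exact forall_glue (P := fun v => cubeNorm (ι ⊕ ι) v ≤ 2) (by simp) hF hG ω

end Pseudorandom

section DualHull

theorem expect_mem_of_convex {α E : Type*} [Fintype α] [Nonempty α] [AddCommGroup E] [Module ℝ E]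
    [Module ℚ≥0 E] {K : Set E} (hK : Convex ℝ K) {f : α → E} (hf : ∀ a, f a ∈ K) :
    𝔼 a, f a ∈ K := by
  rw [Finset.expect, ← NNRat.cast_smul_eq_nnqsmul ℝ, Finset.smul_sum]
  refine hK.sum_mem (fun _ _ => by positivity) ?_ fun a _ => hf a
  simp

variable {ι Z : Type*} [Fintype ι] [DecidableEq ι] [AddCommGroup Z] [Fintype Z]

variable (ι Z) in
/-- The closed convex hull of the dual functions of systems of functions bounded by `1`. It plays
the role of the dual unit ball in the weak comparison of a function with its dense model. -/
noncomputable def dualHull : Set (Z → ℝ) :=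
  closedConvexHull ℝ (dualFun '' {F : (ι → Fin 2) → Z → ℝ | ∀ ω ≠ 0, ∀ x, |F ω x| ≤ 1})

theorem convex_dualHull : Convex ℝ (dualHull ι Z) := convex_closedConvexHull

theorem isClosed_dualHull : IsClosed (dualHull ι Z) := isClosed_closedConvexHull

theorem dualFun_mem_dualHull {F : (ι → Fin 2) → Z → ℝ} (hF : ∀ ω ≠ 0, ∀ x, |F ω x| ≤ 1) :
    dualFun F ∈ dualHull ι Z := subset_closedConvexHull ⟨F, hF, rfl⟩

theorem dualHull_subset {C : Set (Z → ℝ)} (hC : Convex ℝ C) (hC' : IsClosed C)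
    (h : ∀ F : (ι → Fin 2) → Z → ℝ, (∀ ω ≠ 0, ∀ x, |F ω x| ≤ 1) → dualFun F ∈ C) :
    dualHull ι Z ⊆ C :=
  closedConvexHull_min (Set.image_subset_iff.2 h) hC hC'

theorem map_mem_dualHull (L : (Z → ℝ) →ₗ[ℝ] Z → ℝ)
    (hL : ∀ F : (ι → Fin 2) → Z → ℝ, (∀ ω ≠ 0, ∀ x, |F ω x| ≤ 1) → L (dualFun F) ∈ dualHull ι Z)
    {φ : Z → ℝ} (hφ : φ ∈ dualHull ι Z) : L φ ∈ dualHull ι Z :=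
  dualHull_subset (convex_dualHull.linear_preimage L)
    (isClosed_dualHull.preimage L.continuous_of_finiteDimensional) hL hφ

theorem one_mem_dualHull : (1 : Z → ℝ) ∈ dualHull ι Z := by
  rw [← dualFun_one (ι := ι)]
  exact dualFun_mem_dualHull (by simp)

theorem dualHull_subset_box : dualHull ι Z ⊆ Set.univ.pi fun _ => Set.Icc (-1) 1 :=
  dualHull_subset (convex_pi fun _ _ => convex_Icc _ _)
    (isClosed_set_pi fun _ _ => isClosed_Icc)
    fun _ hF x _ => abs_le.1 (abs_dualFun_le_one hF x)

theorem isCompact_dualHull : IsCompact (dualHull ι Z) :=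
  (isCompact_univ_pi fun _ => isCompact_Icc).of_isClosed_subset isClosed_dualHull
    dualHull_subset_box

theorem abs_le_one_of_mem_dualHull {φ : Z → ℝ} (hφ : φ ∈ dualHull ι Z) (x : Z) : |φ x| ≤ 1 :=
  abs_le.2 (dualHull_subset_box hφ x (Set.mem_univ x))

theorem neg_dualFun [Nonempty ι] (F : (ι → Fin 2) → Z → ℝ) :
    -dualFun F = dualFun (Function.update F 1 (-F 1)) := by
  funext x
  rw [Pi.neg_apply, dualFun, ← Finset.expect_neg_distrib]
  refine Finset.expect_congr rfl fun h _ => ?_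
  have one_mem : (1 : ι → Fin 2) ∈ ({0}ᶜ : Finset (ι → Fin 2)) := by simp [funext_iff]
  rw [← Finset.mul_prod_erase _ _ one_mem, ← Finset.mul_prod_erase _ _ one_mem, ← neg_mul,
    Function.update_self]
  refine congrArg₂ (· * ·) rfl (Finset.prod_congr rfl fun ω hω => ?_)
  rw [Function.update_of_ne (Finset.ne_of_mem_erase hω)]

theorem neg_mem_dualHull [Nonempty ι] {φ : Z → ℝ} (hφ : φ ∈ dualHull ι Z) :
    -φ ∈ dualHull ι Z := by
  refine map_mem_dualHull (-LinearMap.id) (fun F hF => ?_) hφ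
  rw [LinearMap.neg_apply, LinearMap.id_apply, neg_dualFun]
  refine dualFun_mem_dualHull fun ω hω x => ?_
  rcases eq_or_ne ω 1 with rfl | hω1
  · simpa using hF 1 hω x
  · rw [Function.update_of_ne hω1]; exact hF ω hω x

/-- Shifting the edges of one of the two cubes by `t` turns the product into an average of dual
functions over `t`. -/
theorem dualFun_mul_dualFun (F G : (ι → Fin 2) → Z → ℝ) :
    dualFun F * dualFun G = 𝔼 t : ι → Z, dualFun fun ω y => F ω y * G ω (cubeVertex y t ω) := by
  funext x
  calc dualFun F x * dualFun G x
      = 𝔼 h : ι → Z, 𝔼 t : ι → Z, (∏ ω ∈ {0}ᶜ, F ω (cubeVertex x h ω)) *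
          ∏ ω ∈ {0}ᶜ, G ω (cubeVertex x t ω) := Finset.expect_mul_expect _ _ _ _
    _ = 𝔼 h : ι → Z, 𝔼 t : ι → Z, (∏ ω ∈ {0}ᶜ, F ω (cubeVertex x h ω)) *
          ∏ ω ∈ {0}ᶜ, G ω (cubeVertex x (h + t) ω) :=
        Finset.expect_congr rfl fun h _ =>
          (Fintype.expect_equiv (Equiv.addLeft h) _ _ fun _ => rfl).symm
    _ = 𝔼 t : ι → Z, 𝔼 h : ι → Z, ∏ ω ∈ {0}ᶜ,
          F ω (cubeVertex x h ω) * G ω (cubeVertex (cubeVertex x h ω) t ω) := by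
        simp only [Finset.prod_mul_distrib, cubeVertex_cubeVertex]
        exact Finset.expect_comm _ _ _
    _ = (𝔼 t : ι → Z, dualFun fun ω y => F ω y * G ω (cubeVertex y t ω)) x := by
        rw [Finset.expect_apply]
        rfl

theorem mul_mem_dualHull {φ ψ : Z → ℝ} (hφ : φ ∈ dualHull ι Z) (hψ : ψ ∈ dualHull ι Z) :
    φ * ψ ∈ dualHull ι Z := by
  refine map_mem_dualHull ((LinearMap.mul ℝ (Z → ℝ)).flip ψ) (fun F hF => ?_) hφ
  refine map_mem_dualHull (LinearMap.mul ℝ (Z → ℝ) (dualFun F)) (fun G hG => ?_) hψ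
  rw [LinearMap.mul_apply', dualFun_mul_dualFun]
  refine expect_mem_of_convex convex_dualHull fun t => dualFun_mem_dualHull fun ω hω x => ?_
  rw [abs_mul]
  exact mul_le_one₀ (hF ω hω _) (abs_nonneg _) (hG ω hω _)

theorem pow_mem_dualHull {φ : Z → ℝ} (hφ : φ ∈ dualHull ι Z) (n : ℕ) : φ ^ n ∈ dualHull ι Z := by
  induction n with
  | zero => simpa using one_mem_dualHull
  | succ n ih => rw [pow_succ]; exact mul_mem_dualHull ih hφ

theorem dualHull_subset_dualHull_sum {κ : Type*} [Fintype κ] [DecidableEq κ] :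
    dualHull ι Z ⊆ dualHull (ι ⊕ κ) Z := by
  refine dualHull_subset convex_dualHull isClosed_dualHull fun F hF => ?_
  rw [← mul_one (dualFun F), ← dualFun_one (ι := κ), ← dualFun_glue]
  refine dualFun_mem_dualHull fun ω hω x => ?_
  unfold glue
  split_ifs with hr hl
  · refine hF _ (fun hl => hω ?_) x
    rw [← Sum.elim_comp_inl_inr ω, hl, hr, Sum.elim_zero_zero]
  · simp
  · simp

variable (ι) in
/-- The average of `a` against every function of `dualHull ι Z` is at most `δ` in absolute value:
the weak form of uniformity in which a function is compared with its dense model. -/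
def IsDualSmall (δ : ℝ) (a : Z → ℝ) : Prop :=
  ∀ φ ∈ dualHull ι Z, |𝔼 x, a x * φ x| ≤ δ

theorem isDualSmall_cubeNorm [Nonempty ι] (a : Z → ℝ) : IsDualSmall ι (cubeNorm ι a) a := by
  intro φ hφ
  let L : (Z → ℝ) →ₗ[ℝ] ℝ :=
    { toFun := fun ψ => 𝔼 x, a x * ψ x
      map_add' := fun u v => by simp only [Pi.add_apply, mul_add, Finset.expect_add_distrib]
      map_smul' := fun r u => by
        simp only [Pi.smul_apply, smul_eq_mul, Finset.mul_expect, RingHom.id_apply, mul_left_comm] }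
  exact abs_le.2 (dualHull_subset ((convex_Icc (-cubeNorm ι a) (cubeNorm ι a)).linear_preimage L)
    (isClosed_Icc.preimage L.continuous_of_finiteDimensional)
    (fun F hF => abs_le.1 (abs_expect_mul_dualFun_le hF a)) hφ)

namespace IsDualSmall

variable {a b : Z → ℝ} {δ ε : ℝ}

theorem of_cubeNorm_sum_le [Nonempty ι] (ha : cubeNorm (ι ⊕ ι) a ≤ δ) : IsDualSmall ι δ a :=
  fun φ hφ => (isDualSmall_cubeNorm a φ (dualHull_subset_dualHull_sum hφ)).trans ha

theorem mono (ha : IsDualSmall ι δ a) (h : δ ≤ ε) : IsDualSmall ι ε a :=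
  fun φ hφ => (ha φ hφ).trans h

theorem sub (ha : IsDualSmall ι δ a) (hb : IsDualSmall ι ε b) : IsDualSmall ι (δ + ε) (a - b) := by
  intro φ hφ
  simp only [Pi.sub_apply, sub_mul, Finset.expect_sub_distrib]
  exact (abs_sub _ _).trans (add_le_add (ha φ hφ) (hb φ hφ))

theorem const_smul (c : ℝ) (ha : IsDualSmall ι δ a) : IsDualSmall ι (|c| * δ) (c • a) := by
  intro φ hφ
  simp only [Pi.smul_apply, smul_eq_mul, mul_assoc, ← Finset.mul_expect, abs_mul]
  exact mul_le_mul_of_nonneg_left (ha φ hφ) (abs_nonneg c)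

theorem abs_expect_mul_polynomial_le {φ : Z → ℝ} (ha : IsDualSmall ι δ a) (hφ : φ ∈ dualHull ι Z)
    (p : Polynomial ℝ) :
    |𝔼 x, a x * p.eval (φ x)| ≤ (∑ i ∈ Finset.range (p.natDegree + 1), |p.coeff i|) * δ := by
  have expand : 𝔼 x, a x * p.eval (φ x) =
      ∑ i ∈ Finset.range (p.natDegree + 1), p.coeff i * 𝔼 x, a x * (φ ^ i) x := by
    simp only [Finset.mul_expect, ← Finset.expect_sum_comm, Polynomial.eval_eq_sum_range,
      Finset.mul_sum, Pi.pow_apply, mul_left_comm]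
  rw [expand, Finset.sum_mul]
  refine (Finset.abs_sum_le_sum_abs _ _).trans (Finset.sum_le_sum fun i _ => ?_)
  rw [abs_mul]
  exact mul_le_mul_of_nonneg_left (ha _ (pow_mem_dualHull hφ i)) (abs_nonneg _)

end IsDualSmall

end DualHull

section Densification

open scoped Topology

/-- The truncation of a real number to the interval `[-1, 1]`. -/
def truncate (d : ℝ) : ℝ := max (-1) (min 1 d)

theorem abs_truncate_le_one (d : ℝ) : |truncate d| ≤ 1 :=
  abs_le.2 ⟨le_max_left _ _, max_le (by norm_num) (min_le_left _ _)⟩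

theorem abs_sub_truncate_le {d w : ℝ} (h : |d| ≤ w) : |d - truncate d| ≤ |w - 1| := by
  obtain ⟨hwd, hdw⟩ := abs_le.1 h
  have hw : w - 1 ≤ |w - 1| := le_abs_self _
  unfold truncate
  rcases le_total d 1 with h1 | h1 <;> rcases le_total (-1) d with h2 | h2
  · simp [h1, h2]
  · rw [min_eq_right h1, max_eq_left h2, abs_of_nonpos] <;> linarith
  · rw [min_eq_left h1, max_eq_right, abs_of_nonneg] <;> linarith
  · linarith

theorem expect_mul_sq_le_of_abs_le {α : Type*} [Fintype α] {f ν : α → ℝ} (D : α → ℝ)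
    (hf : ∀ x, |f x| ≤ ν x) :
    (𝔼 x, f x * D x) ^ 2 ≤ (𝔼 x, ν x) * 𝔼 x, ν x * D x ^ 2 := by
  have hν : ∀ x, 0 ≤ ν x := fun x => (abs_nonneg _).trans (hf x)
  have abs_le_sqrt : |𝔼 x, f x * D x| ≤ 𝔼 x, √(ν x) * (√(ν x) * |D x|) := by
    refine (Finset.abs_expect_le _ _).trans (Finset.expect_le_expect fun x _ => ?_)
    rw [abs_mul, ← mul_assoc, Real.mul_self_sqrt (hν x)]
    exact mul_le_mul_of_nonneg_right (hf x) (abs_nonneg _)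
  have cauchy_schwarz := Finset.expect_mul_sq_le_sq_mul_sq Finset.univ
    (fun x => √(ν x)) (fun x => √(ν x) * |D x|)
  simp only [mul_pow, sq_abs, Real.sq_sqrt (hν _)] at cauchy_schwarz
  rw [← sq_abs]
  exact (pow_le_pow_left₀ (abs_nonneg _) abs_le_sqrt 2).trans cauchy_schwarz

theorem expect_sq_le_of_expect_truncate_mul_le {α : Type*} [Fintype α] [Nonempty α]
    {D W : α → ℝ} {κ : ℝ} (hκ0 : 0 ≤ κ) (hκ1 : κ ≤ 1) (hDW : ∀ x, |D x| ≤ W x)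
    (hW : 𝔼 x, (W x - 1) ^ 2 ≤ κ ^ 2) (hT : 𝔼 x, truncate (D x) * D x ≤ κ) :
    𝔼 x, D x ^ 2 ≤ 3 * κ := by
  have expect_abs_le : 𝔼 x, |W x - 1| ≤ κ := by
    refine abs_le_of_sq_le_sq' (le_trans ?_ hW) hκ0 |>.2
    simpa using Finset.expect_mul_sq_le_sq_mul_sq Finset.univ (fun x => |W x - 1|) fun _ => (1 : ℝ)
  have sq_le (x : α) : D x ^ 2 ≤ truncate (D x) * D x + ((W x - 1) ^ 2 + |W x - 1|) := by
    have h : (D x - truncate (D x)) * D x ≤ |W x - 1| * W x := by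
      refine (le_abs_self _).trans ?_
      rw [abs_mul]
      exact mul_le_mul (abs_sub_truncate_le (hDW x)) (hDW x) (abs_nonneg _) (abs_nonneg _)
    nlinarith [sq_abs (W x - 1), abs_nonneg (W x - 1), le_abs_self (W x - 1)]
  have h := Finset.expect_le_expect (s := Finset.univ) fun x _ => sq_le x
  rw [Finset.expect_add_distrib, Finset.expect_add_distrib] at h
  nlinarith

variable {ι : Type*} [Fintype ι] [DecidableEq ι] [Nonempty ι]

section Majorants

variable {Z : Type*} [AddCommGroup Z] [Fintype Z] {F V : (ι → Fin 2) → Z → ℝ} {δ κ : ℝ}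

theorem expect_dualFun_sub_one_sq_le (hδ : δ ≤ 1) (hV : ∀ ω, cubeNorm (ι ⊕ ι) (V ω - 1) ≤ δ) :
    𝔼 x, (dualFun V x - 1) ^ 2 ≤ 3 * (2 ^ 2 ^ Fintype.card (ι ⊕ ι) * δ) := by
  have h1 : cubeNorm (ι ⊕ ι) ((1 : Z → ℝ) - 1) ≤ δ := by
    simpa using (cubeNorm_nonneg (V 0 - 1)).trans (hV 0)
  have second_moment := abs_expect_mul_dualFun_mul_dualFun_sub_one_le hδ h1 hV hV
  have first_moment := abs_expect_mul_dualFun_mul_dualFun_sub_one_le (W := 1) hδ h1 hV fun _ => h1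
  simp only [dualFun_one, Pi.one_apply, one_mul, mul_one] at first_moment second_moment
  have expand : 𝔼 x, (dualFun V x - 1) ^ 2 =
      (𝔼 x, dualFun V x * dualFun V x) - 2 * (𝔼 x, dualFun V x) + 1 := by
    simp only [sub_sq, ← sq, one_pow, mul_one, Finset.expect_add_distrib,
      Finset.expect_sub_distrib, Finset.mul_expect, Fintype.expect_const]
  linarith [(abs_le.1 second_moment).2, (abs_le.1 first_moment).1]

/-- By Cauchy–Schwarz with respect to the majorant of `F σ`, the function `F σ` may be replaced by
the truncation of the dual function it is tested against. -/
theorem cubeAvg_sq_le_of_truncate (hδ : δ ≤ 1) (hV : ∀ ω, cubeNorm (ι ⊕ ι) (V ω - 1) ≤ δ)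
    (hFV : ∀ ω x, |F ω x| ≤ V ω x) (hκ0 : 0 ≤ κ) (hκ1 : κ ≤ 1)
    (hδκ : 3 * 2 ^ 2 ^ Fintype.card (ι ⊕ ι) * δ ≤ κ ^ 2) (σ : ι → Fin 2)
    (h : cubeAvg (Function.update F σ (truncate ∘ dualFun fun ω => F (ω + σ))) ≤ κ) :
    cubeAvg F ^ 2 ≤ 8 * κ := by
  set D := dualFun fun ω => F (ω + σ) with hD
  have cubeNorm_F_le (ω) : cubeNorm (ι ⊕ ι) (F ω) ≤ 2 := cubeNorm_le_two (hFV ω) ((hV ω).trans hδ)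
  have expect_majorant_le : 𝔼 x, V σ x ≤ 2 := by
    have h := (abs_expect_le_cubeNorm _).trans ((hV σ).trans hδ)
    simp only [Pi.sub_apply, Pi.one_apply, Finset.expect_sub_distrib, Fintype.expect_one] at h
    linarith [(abs_le.1 h).2]
  have expect_D_sq_le : 𝔼 x, D x ^ 2 ≤ 3 * κ := by
    refine expect_sq_le_of_expect_truncate_mul_le (W := dualFun fun ω => V (ω + σ)) hκ0 hκ1
      (abs_dualFun_le fun ω _ => hFV _) ?_ ?_
    · linarith [expect_dualFun_sub_one_sq_le hδ fun ω => hV (ω + σ)]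
    · rwa [cubeAvg_update] at h
  have expect_majorant_mul_D_sq_le : 𝔼 x, V σ x * D x ^ 2 ≤ 4 * κ := by
    have h := abs_expect_mul_dualFun_mul_dualFun_le (hV σ) (fun ω => cubeNorm_F_le (ω + σ))
      fun ω => cubeNorm_F_le (ω + σ)
    simp only [Pi.sub_apply, Pi.one_apply, sub_one_mul, Finset.expect_sub_distrib, ← hD,
      ← sq] at h
    nlinarith [(abs_le.1 h).2]
  calc cubeAvg F ^ 2 = (𝔼 x, F σ x * D x) ^ 2 := by rw [cubeAvg_eq_expect_mul_dualFun F σ]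
    _ ≤ (𝔼 x, V σ x) * 𝔼 x, V σ x * D x ^ 2 := expect_mul_sq_le_of_abs_le D (hFV σ)
    _ ≤ 2 * (4 * κ) :=
        mul_le_mul expect_majorant_le expect_majorant_mul_D_sq_le (Finset.expect_nonneg fun x _ =>
          mul_nonneg ((abs_nonneg _).trans (hFV σ x)) (sq_nonneg _)) zero_le_two
    _ = 8 * κ := by ring

end Majorants

theorem eventually_mul_le (C : ℝ) {c : ℝ} (hc : 0 < c) : ∀ᶠ δ in 𝓝[>] (0 : ℝ), C * δ ≤ c := by
  have h : Filter.Tendsto (C * ·) (𝓝[>] 0) (𝓝 (C * 0)) :=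
    (continuous_const_mul C).continuousAt.mono_left nhdsWithin_le_nhds
  exact h.eventually_le_const (by simpa using hc)

/-- Densification: induction on the number of vertices other than `ω₀` whose function is not
bounded by `1`. -/
theorem eventually_abs_cubeAvg_le_of_dualHull (n : ℕ) {ε : ℝ} (hε : 0 < ε) :
    ∀ᶠ δ in 𝓝[>] (0 : ℝ), ∀ (Z : Type*) [AddCommGroup Z] [Fintype Z]
      (F V : (ι → Fin 2) → Z → ℝ) (ω₀ : ι → Fin 2) (S : Finset (ι → Fin 2)), S.card = n → ω₀ ∉ S →
      (∀ ω x, |F ω x| ≤ V ω x) → (∀ ω, cubeNorm (ι ⊕ ι) (V ω - 1) ≤ δ) →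
      (∀ ω ∉ S, ω ≠ ω₀ → V ω = 1) → IsDualSmall ι δ (F ω₀) → |cubeAvg F| ≤ ε := by
  induction n generalizing ε with
  | zero =>
    filter_upwards [eventually_mul_le 1 hε] with δ hδ Z _ _ F V ω₀ S hS _ hFV _ hV1 hweak
    rw [Finset.card_eq_zero] at hS
    rw [cubeAvg_eq_expect_mul_dualFun F ω₀]
    refine (hweak _ (dualFun_mem_dualHull fun ω hω x => ?_)).trans (by linarith)
    simpa [hV1 (ω + ω₀) (by simp [hS]) (by simpa using hω)] using hFV (ω + ω₀) x
  | succ n ih =>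
    set κ := min (ε ^ 2 / 8) 1
    have hκ0 : 0 < κ := lt_min (by positivity) one_pos
    filter_upwards [ih hκ0, eventually_mul_le 1 one_pos,
      eventually_mul_le (3 * 2 ^ 2 ^ Fintype.card (ι ⊕ ι)) (pow_pos hκ0 2)]
      with δ ih hδ1 hδκ Z _ _ F V ω₀ S hS hω₀ hFV hV hV1 hweak
    obtain ⟨σ, hσ⟩ : S.Nonempty := Finset.card_pos.1 (by omega)
    have hσω₀ : ω₀ ≠ σ := fun h => hω₀ (h ▸ hσ)
    have h := ih Z (Function.update F σ (truncate ∘ dualFun fun ω => F (ω + σ)))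
      (Function.update V σ 1) ω₀ (S.erase σ) (by rw [Finset.card_erase_of_mem hσ, hS]; rfl)
      (fun h => hω₀ (Finset.mem_of_mem_erase h)) (fun ω x => ?_) (fun ω => ?_)
      (fun ω hω hω' => ?_) (by simpa only [Function.update_of_ne hσω₀] using hweak)
    · refine abs_le_of_sq_le_sq ((cubeAvg_sq_le_of_truncate (by linarith) hV hFV hκ0.le
        (min_le_right _ _) hδκ σ ((le_abs_self _).trans h)).trans ?_) hε.le
      linarith [min_le_left (ε ^ 2 / 8) 1]
    · rcases eq_or_ne ω σ with rfl | hωσ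
      · simpa using abs_truncate_le_one _
      · simpa only [Function.update_of_ne hωσ] using hFV ω x
    · rcases eq_or_ne ω σ with rfl | hωσ
      · simpa using (cubeNorm_nonneg (V ω - 1)).trans (hV ω)
      · simpa only [Function.update_of_ne hωσ] using hV ω
    · rcases eq_or_ne ω σ with rfl | hωσ
      · simp
      · rw [Function.update_of_ne hωσ]
        exact hV1 ω (fun h => hω (Finset.mem_erase.2 ⟨hωσ, h⟩)) hω'

end Densification

section DenseModel

open scoped Topology

/-- Sion's minimax theorem for the pairing of the functions `g : Z → [0, 1]` with `K`. The
hypothesis is the minimax inequality, since `𝔼 x, max (φ x) 0` is the supremum over `g` of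
`𝔼 x, g x * φ x`. -/
theorem exists_forall_expect_sub_mul_le {Z : Type*} [Fintype Z] {f : Z → ℝ} {K : Set (Z → ℝ)}
    {δ : ℝ} (hK : Convex ℝ K) (hKc : IsCompact K) (hKn : K.Nonempty)
    (h : ∀ φ ∈ K, 𝔼 x, f x * φ x ≤ (𝔼 x, max (φ x) 0) + δ) :
    ∃ g ∈ Set.Icc (0 : Z → ℝ) 1, ∀ φ ∈ K, 𝔼 x, (f x - g x) * φ x ≤ δ := by
  have hcont : Continuous fun p : (Z → ℝ) × (Z → ℝ) => 𝔼 x, (f x - p.1 x) * p.2 x := by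
    simp only [Fintype.expect_eq_sum_div_card]
    fun_prop
  have affine_left (φ : Z → ℝ) :
      ConvexOn ℝ (Set.Icc (0 : Z → ℝ) 1) fun g => 𝔼 x, (f x - g x) * φ x := by
    refine ⟨convex_Icc _ _, fun u _ v _ r t _ _ hrt => le_of_eq ?_⟩
    simp only [Pi.add_apply, Pi.smul_apply, smul_eq_mul, Finset.mul_expect,
      ← Finset.expect_add_distrib]
    refine Finset.expect_congr rfl fun x _ => ?_
    linear_combination (-(f x * φ x)) * hrt
  have affine_right (g : Z → ℝ) : ConcaveOn ℝ K fun φ => 𝔼 x, (f x - g x) * φ x := by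
    refine ⟨hK, fun u _ v _ r t _ _ _ => le_of_eq ?_⟩
    simp only [Pi.add_apply, Pi.smul_apply, smul_eq_mul, Finset.mul_expect,
      ← Finset.expect_add_distrib]
    exact Finset.expect_congr rfl fun x _ => by ring
  obtain ⟨g, hg, φ₀, hφ₀, saddle⟩ := Sion.exists_isSaddlePointOn
    (X := Set.Icc (0 : Z → ℝ) 1) (Y := K) (f := fun g φ => 𝔼 x, (f x - g x) * φ x)
    ⟨0, le_rfl, zero_le_one⟩ (convex_Icc _ _) isCompact_Icc
    (fun φ _ => (hcont.comp (by fun_prop : Continuous fun g : Z → ℝ =>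
      (g, φ))).lowerSemicontinuous.lowerSemicontinuousOn _)
    (fun φ _ => (affine_left φ).quasiconvexOn) hK hKn hKc
    (fun g _ => (hcont.comp (by fun_prop : Continuous fun φ : Z → ℝ =>
      (g, φ))).upperSemicontinuous.upperSemicontinuousOn _)
    (fun g _ => (affine_right g).quasiconcaveOn)
  let g₀ : Z → ℝ := fun x => if 0 < φ₀ x then 1 else 0
  have g₀_mem : g₀ ∈ Set.Icc (0 : Z → ℝ) 1 :=
    ⟨fun x => by dsimp only [g₀]; split_ifs <;> simp,
      fun x => by dsimp only [g₀]; split_ifs <;> simp⟩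
  have g₀_mul (x : Z) : g₀ x * φ₀ x = max (φ₀ x) 0 := by
    rcases lt_or_ge 0 (φ₀ x) with hx | hx
    · simp [g₀, hx, hx.le]
    · simp [g₀, hx, hx.not_gt]
  refine ⟨g, hg, fun φ hφ => (saddle g₀ g₀_mem φ hφ).trans ?_⟩
  simp only [sub_mul, g₀_mul, Finset.expect_sub_distrib]
  linarith [h φ₀ hφ₀]

variable {ι : Type*} [Fintype ι] [DecidableEq ι]

/-- By Weierstrass approximation, since the powers of `φ` stay in `dualHull ι Z`. -/
theorem eventually_abs_expect_sub_one_mul_comp_le {g : ℝ → ℝ}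
    (hg : ContinuousOn g (Set.Icc (-1) 1)) {ε : ℝ} (hε : 0 < ε) :
    ∀ᶠ δ in 𝓝[>] (0 : ℝ), ∀ (Z : Type*) [AddCommGroup Z] [Fintype Z] (ν φ : Z → ℝ), 0 ≤ ν →
      IsDualSmall ι δ (ν - 1) → φ ∈ dualHull ι Z → |𝔼 x, (ν x - 1) * g (φ x)| ≤ ε := by
  obtain ⟨p, hp⟩ := exists_polynomial_near_of_continuousOn (-1) 1 g hg (ε / 6) (by positivity)
  filter_upwards [eventually_mul_le 1 one_pos,
    eventually_mul_le (∑ i ∈ Finset.range (p.natDegree + 1), |p.coeff i|) (half_pos hε)]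
    with δ hδ1 hδp Z _ _ ν φ hν hν1 hφ
  have expect_add_one_le : 𝔼 x, (ν x + 1) ≤ 3 := by
    have h := hν1 1 one_mem_dualHull
    simp only [Pi.sub_apply, Pi.one_apply, mul_one, Finset.expect_sub_distrib,
      Fintype.expect_one] at h
    rw [Finset.expect_add_distrib, Fintype.expect_one]
    linarith [(abs_le.1 h).2]
  have error_le : |𝔼 x, (ν x - 1) * (g (φ x) - p.eval (φ x))| ≤ ε / 2 :=
    calc |𝔼 x, (ν x - 1) * (g (φ x) - p.eval (φ x))|
        ≤ 𝔼 x, (ν x + 1) * (ε / 6) := by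
          refine (Finset.abs_expect_le _ _).trans (Finset.expect_le_expect fun x _ => ?_)
          have hνx : 0 ≤ ν x := hν x
          rw [abs_mul, abs_sub_comm (g _)]
          exact mul_le_mul (abs_le.2 ⟨by linarith, by linarith⟩)
            (hp _ (abs_le.1 (abs_le_one_of_mem_dualHull hφ x))).le (abs_nonneg _) (by linarith)
      _ ≤ 3 * (ε / 6) := by
          rw [← Finset.expect_mul]
          exact mul_le_mul_of_nonneg_right expect_add_one_le (by positivity)
      _ = ε / 2 := by ring
  calc |𝔼 x, (ν x - 1) * g (φ x)|
      = |(𝔼 x, (ν x - 1) * p.eval (φ x)) + 𝔼 x, (ν x - 1) * (g (φ x) - p.eval (φ x))| := by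
        rw [← Finset.expect_add_distrib]
        exact congrArg _ (Finset.expect_congr rfl fun x _ => by ring)
    _ ≤ ε / 2 + ε / 2 :=
        (abs_add_le _ _).trans
          (add_le_add ((hν1.abs_expect_mul_polynomial_le hφ p).trans hδp) error_le)
    _ = ε := add_halves ε

variable [Nonempty ι]

theorem eventually_exists_mem_Icc_isDualSmall_sub {ε : ℝ} (hε : 0 < ε) :
    ∀ᶠ δ in 𝓝[>] (0 : ℝ), ∀ (Z : Type*) [AddCommGroup Z] [Fintype Z] (ν f : Z → ℝ),
      IsDualSmall ι δ (ν - 1) → f ∈ Set.Icc 0 ν →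
      ∃ g ∈ Set.Icc (0 : Z → ℝ) 1, IsDualSmall ι ε (f - g) := by
  filter_upwards [eventually_abs_expect_sub_one_mul_comp_le (ι := ι) (g := fun t => max t 0)
    (by fun_prop) hε] with δ hδ Z _ _ ν f hν hf
  have expect_mul_le (φ : Z → ℝ) (hφ : φ ∈ dualHull ι Z) :
      𝔼 x, f x * φ x ≤ (𝔼 x, max (φ x) 0) + ε :=
    calc 𝔼 x, f x * φ x ≤ 𝔼 x, ν x * max (φ x) 0 := Finset.expect_le_expect fun x _ =>
          (mul_le_mul_of_nonneg_left (le_max_left _ 0) (hf.1 x)).trans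
            (mul_le_mul_of_nonneg_right (hf.2 x) (le_max_right _ _))
      _ = (𝔼 x, max (φ x) 0) + 𝔼 x, (ν x - 1) * max (φ x) 0 := by
          rw [← Finset.expect_add_distrib]
          exact Finset.expect_congr rfl fun x _ => by ring
      _ ≤ (𝔼 x, max (φ x) 0) + ε :=
          add_le_add_right ((le_abs_self _).trans (hδ Z ν φ (hf.1.trans hf.2) hν hφ)) _
  obtain ⟨g, hg, hfg⟩ := exists_forall_expect_sub_mul_le convex_dualHull isCompact_dualHull
    ⟨1, one_mem_dualHull⟩ expect_mul_le
  refine ⟨g, hg, fun φ hφ => abs_le.2 ⟨?_, hfg φ hφ⟩⟩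
  have h := hfg _ (neg_mem_dualHull hφ)
  simp only [Pi.neg_apply, mul_neg, Finset.expect_neg_distrib] at h
  exact neg_le.1 h

theorem eventually_exists_isDualSmall_sub {ε : ℝ} (hε : 0 < ε) :
    ∀ᶠ δ in 𝓝[>] (0 : ℝ), ∀ (Z : Type*) [AddCommGroup Z] [Fintype Z] (ν f : Z → ℝ),
      IsDualSmall ι δ (ν - 1) → (∀ x, |f x| ≤ ν x) →
      ∃ g : Z → ℝ, (∀ x, |g x| ≤ 1) ∧ (0 ≤ f → 0 ≤ g) ∧ IsDualSmall ι ε (f - g) := by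
  filter_upwards [eventually_exists_mem_Icc_isDualSmall_sub (ι := ι) (half_pos hε)]
    with δ hδ Z _ _ ν f hν hf
  obtain ⟨g, ⟨hg0, hg1⟩, hfg⟩ := hδ Z ν f⁺ hν ⟨posPart_nonneg f, fun x =>
    (max_le (le_abs_self (f x)) (abs_nonneg _)).trans (hf x)⟩
  by_cases hf0 : 0 ≤ f
  · rw [posPart_of_nonneg hf0] at hfg
    exact ⟨g, fun x => abs_le.2 ⟨by linarith [show 0 ≤ g x from hg0 x], hg1 x⟩, fun _ => hg0,
      hfg.mono (half_le_self hε.le)⟩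
  · obtain ⟨g', ⟨hg'0, hg'1⟩, hfg'⟩ := hδ Z ν f⁻ hν ⟨negPart_nonneg f, fun x =>
      (max_le (neg_le_abs (f x)) (abs_nonneg _)).trans (hf x)⟩
    refine ⟨g - g', fun x => ?_, fun h => absurd h hf0, ?_⟩
    · exact (abs_sub_le_of_le_of_le (hg0 x) (hg1 x) (hg'0 x) (hg'1 x)).trans_eq (sub_zero 1)
    have h := hfg.sub hfg'
    rwa [sub_sub_sub_comm, posPart_sub_negPart, add_halves] at h

theorem eventually_cubeNorm_sub_le {ε : ℝ} (hε : 0 < ε) :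
    ∀ᶠ δ in 𝓝[>] (0 : ℝ), ∀ (Z : Type*) [AddCommGroup Z] [Fintype Z] (ν f g : Z → ℝ),
      cubeNorm (ι ⊕ ι) (ν - 1) ≤ δ → (∀ x, |f x| ≤ ν x) → (∀ x, |g x| ≤ 1) →
      IsDualSmall ι δ (f - g) → cubeNorm ι (f - g) ≤ ε := by
  have half_pow_pos : 0 < (ε / 2) ^ 2 ^ Fintype.card ι := by positivity
  filter_upwards [eventually_abs_cubeAvg_le_of_dualHull (ι := ι)
    (Finset.card {ω : ι → Fin 2 | ω ≠ 0}) half_pow_pos, self_mem_nhdsWithin]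
    with δ hδ hδ0 Z _ _ ν f g hν hf hg hfg
  have half_le : |(1 / 2 : ℝ)| * δ ≤ δ := by
    rw [abs_of_pos one_half_pos]; linarith [Set.mem_Ioi.1 hδ0]
  -- `f - g` is majorised by `ν + 1`, and `1 / 2` normalises this majorant to be close to `1`.
  have h := hδ Z (fun _ => (1 / 2 : ℝ) • (f - g)) (fun _ => (1 / 2 : ℝ) • (ν + 1)) 0 _ rfl
    (by simp) (fun _ x => ?_) (fun _ => ?_) (by simp) ((hfg.const_smul _).mono half_le)
  · have h2 := cubeNorm_le_of_cubeAvg_le (by positivity) ((le_abs_self _).trans h)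
    rw [cubeNorm_smul, abs_of_pos one_half_pos] at h2
    linarith
  · simp only [Pi.smul_apply, Pi.sub_apply, Pi.add_apply, Pi.one_apply, smul_eq_mul, abs_mul,
      abs_of_pos (one_half_pos (α := ℝ))]
    linarith [abs_sub (f x) (g x), hf x, hg x]
  · rw [show (1 / 2 : ℝ) • (ν + 1) - 1 = (1 / 2 : ℝ) • (ν - 1) by ext x; simp; ring, cubeNorm_smul]
    exact (mul_le_mul_of_nonneg_left hν (abs_nonneg _)).trans half_le

end DenseModel

section Localisation

theorem expect_indicator_one_mul {α : Type*} [Fintype α] (A : Finset α) (f : α → ℝ) :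
    𝔼 x, Set.indicator (A : Set α) 1 x * f x = A.dens * 𝔼 x ∈ A, f x := by
  classical
  rcases A.eq_empty_or_nonempty with rfl | hA
  · simp
  have : Nonempty α := hA.to_type
  have card_ne : (A.card : ℝ) ≠ 0 := by exact_mod_cast hA.card_ne_zero
  simp only [Finset.expect_eq_sum_div_card, Finset.card_univ, Finset.nnratCast_dens,
    Set.indicator_apply, Finset.mem_coe, Pi.one_apply, boole_mul, Finset.sum_ite_mem,
    Finset.univ_inter]
  field_simp

theorem dualFun_fin_two {Z : Type*} [AddCommGroup Z] [Fintype Z] (F : (Fin 2 → Fin 2) → Z → ℝ)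
    (x : Z) :
    dualFun F x = 𝔼 a, 𝔼 b, F ![1, 0] (x + a) * F ![0, 1] (x + b) * F ![1, 1] (x + (a + b)) := by
  have compl_zero : ({0}ᶜ : Finset (Fin 2 → Fin 2)) = {![1, 0], ![0, 1], ![1, 1]} := by decide
  rw [← Finset.expect_product', Finset.univ_product_univ]
  refine Fintype.expect_equiv (finTwoArrowEquiv Z) _ _ fun h => ?_
  simp [compl_zero, cubeVertex, mul_assoc]

/-- The average of `1_B (a + b - x)` over `a, b ∈ A`: a smooth cutoff in `x` that is proportional to
a dual function. -/
noncomputable def cutoff {Z : Type*} [AddCommGroup Z] (A B : Finset Z) (x : Z) : ℝ :=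
  𝔼 a ∈ A, 𝔼 b ∈ A, Set.indicator (B : Set Z) 1 (a + b - x)

section Cutoff

variable {Z : Type*} [AddCommGroup Z] {A B : Finset Z}

theorem cutoff_nonneg (x : Z) : 0 ≤ cutoff A B x :=
  Finset.expect_nonneg fun _ _ => Finset.expect_nonneg fun _ _ =>
    Set.indicator_nonneg (fun _ _ => zero_le_one) _

theorem cutoff_eq_one (hA : A.Nonempty) {x : Z} (hB : ∀ a ∈ A, ∀ b ∈ A, a + b - x ∈ B) :
    cutoff A B x = 1 :=
  calc cutoff A B x = 𝔼 _ ∈ A, 𝔼 _ ∈ A, (1 : ℝ) :=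
        Finset.expect_congr rfl fun a ha => Finset.expect_congr rfl fun b hb =>
          Set.indicator_of_mem (hB a ha b hb) _
    _ = 1 := by simp [hA]

variable [Fintype Z]

theorem expect_cutoff (hA : A.Nonempty) : 𝔼 x, cutoff A B x = B.dens := by
  have expect_translate (a b : Z) :
      𝔼 x, Set.indicator (B : Set Z) (1 : Z → ℝ) (a + b - x) = B.dens := by
    rw [← Finset.expect_indicator_one]
    exact Fintype.expect_equiv (Equiv.subLeft (a + b)) _ _ fun _ => rfl
  unfold cutoff
  rw [Finset.expect_comm]
  simp only [Finset.expect_comm Finset.univ A, expect_translate, Finset.expect_const hA]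

theorem smul_cutoff_mem_dualHull : ((A.dens : ℝ) ^ 2) • cutoff A B ∈ dualHull (Fin 2) Z := by
  let F (ω : Fin 2 → Fin 2) : Z → ℝ :=
    ![![1, Set.indicator A 1], ![Set.indicator A 1, Set.indicator B 1]] (ω 0) (ω 1)
  have abs_indicator_le (S : Finset Z) (x : Z) : |Set.indicator (S : Set Z) (1 : Z → ℝ) x| ≤ 1 := by
    classical
    rw [Set.indicator_apply]
    split_ifs <;> simp
  suffices h : ((A.dens : ℝ) ^ 2) • cutoff A B = dualFun F by
    rw [h]
    refine dualFun_mem_dualHull fun ω _ => ?_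
    simp only [F]
    generalize ω 0 = i, ω 1 = j
    fin_cases i <;> fin_cases j <;> simp [abs_indicator_le]
  funext x
  calc ((A.dens : ℝ) ^ 2) * cutoff A B x
      = 𝔼 a, 𝔼 b, Set.indicator (A : Set Z) 1 a * Set.indicator (A : Set Z) 1 b *
          Set.indicator (B : Set Z) 1 (a + b - x) := by
        simp only [mul_assoc, ← Finset.mul_expect, expect_indicator_one_mul, sq, cutoff]
    _ = dualFun F x := by
        rw [dualFun_fin_two]
        refine (Fintype.expect_equiv (Equiv.addLeft x) _ _ fun a => ?_).symm
        refine Fintype.expect_equiv (Equiv.addLeft x) _ _ fun b => ?_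
        simp only [F, Equiv.coe_addLeft]
        rw [show x + a + (x + b) - x = x + (a + b) by abel]
        rfl

end Cutoff

theorem IsDualSmall.sub_indicator {ι Z : Type*} [Fintype ι] [DecidableEq ι] [AddCommGroup Z]
    [Fintype Z] {I : Finset Z} {f g χ : Z → ℝ} {α ε : ℝ} (hfg : IsDualSmall ι ε (f - g))
    (hf : ∀ x ∉ I, f x = 0) (hg : ∀ x, |g x| ≤ 1) (hα : 0 < α) (hχ : α • χ ∈ dualHull ι Z)
    (hχ_nonneg : 0 ≤ χ) (hχ_one : ∀ x ∈ I, χ x = 1) :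
    IsDualSmall ι (α⁻¹ * ε + ((𝔼 x, χ x) - I.dens)) (f - Set.indicator I g) := by
  intro φ hφ
  classical
  have split (x : Z) : (f - Set.indicator I g) x * φ x =
      α⁻¹ * ((f - g) x * ((α • χ) * φ) x) + g x * (χ x - Set.indicator I 1 x) * φ x := by
    by_cases hx : x ∈ I
    · simp only [Pi.sub_apply, Pi.mul_apply, Pi.smul_apply, smul_eq_mul, Set.indicator_of_mem,
        Finset.mem_coe, hx, hχ_one x hx, Pi.one_apply]
      field_simp
      ring
    · simp only [Pi.sub_apply, Pi.mul_apply, Pi.smul_apply, smul_eq_mul, Set.indicator_of_notMem,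
        Finset.mem_coe, hx, hf x hx, not_false_eq_true]
      field_simp
      ring
  have main := hfg _ (mul_mem_dualHull hχ hφ)
  have error : |𝔼 x, g x * (χ x - Set.indicator (I : Set Z) 1 x) * φ x| ≤ (𝔼 x, χ x) - I.dens := by
    rw [← Finset.expect_indicator_one, ← Finset.expect_sub_distrib]
    refine (Finset.abs_expect_le _ _).trans (Finset.expect_le_expect fun x _ => ?_)
    have nonneg : 0 ≤ χ x - Set.indicator (I : Set Z) 1 x := by
      by_cases hx : x ∈ I <;> simp [hx, hχ_one, show 0 ≤ χ x from hχ_nonneg x]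
    rw [abs_mul, abs_mul, abs_of_nonneg nonneg]
    exact (mul_le_of_le_one_right (by positivity) (abs_le_one_of_mem_dualHull hφ x)).trans
      (mul_le_of_le_one_left nonneg (hg x))
  simp only [split, Finset.expect_add_distrib, ← Finset.mul_expect]
  refine (abs_add_le _ _).trans (add_le_add ?_ error)
  rw [abs_mul, abs_of_pos (inv_pos.2 hα)]
  exact mul_le_mul_of_nonneg_left main (inv_pos.2 hα).le

end Localisation

section IntervalCutoff

open Filter
open scoped Topology

variable {M N : ℕ}

/-- The interval `[N]` inside `ℤ/Mℤ`. -/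
noncomputable def zmodInterval (N M : ℕ) : Finset (ZMod M) := (Finset.Icc (1 : ℤ) N).image Int.cast

theorem mem_zmodInterval [NeZero M] (hNM : N < M) {x : ZMod M} :
    x ∈ zmodInterval N M ↔ x.val ∈ Finset.Icc 1 N := by
  simp only [zmodInterval, Finset.mem_image, Finset.mem_Icc]
  refine ⟨?_, fun hx => ⟨x.val, by omega, by simp⟩⟩
  rintro ⟨z, hz, rfl⟩
  lift z to ℕ using by omega
  rw [Int.cast_natCast, ZMod.val_cast_of_lt (by omega)]
  omega

variable [NeZero M]

theorem dens_image_intCast_le (S : Finset ℤ) :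
    ((S.image Int.cast : Finset (ZMod M)).dens : ℝ) ≤ S.card / M := by
  rw [Finset.nnratCast_dens, ZMod.card]
  gcongr
  exact Finset.card_image_le

theorem dens_image_intCast {S : Finset ℤ} (hS : S ⊆ Finset.Ico 0 (M : ℤ)) :
    ((S.image Int.cast : Finset (ZMod M)).dens : ℝ) = S.card / M := by
  rw [Finset.nnratCast_dens, ZMod.card, Finset.card_image_of_injOn]
  intro a ha b hb hab
  have mem_a := Finset.mem_Ico.1 (hS ha)
  have mem_b := Finset.mem_Ico.1 (hS hb)
  have modEq := (ZMod.intCast_eq_intCast_iff' a b M).1 hab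
  rwa [Int.emod_eq_of_lt mem_a.1 mem_a.2, Int.emod_eq_of_lt mem_b.1 mem_b.2] at modEq

theorem dens_zmodInterval (hNM : N < M) : ((zmodInterval N M).dens : ℝ) = N / M := by
  rw [zmodInterval, dens_image_intCast fun z hz => by simp at hz ⊢; omega]
  simp

theorem exists_cutoff_zmodInterval (hNM : N < M) {δ : ℝ} (hδ : 0 < δ) (hδ1 : δ ≤ 1)
    (hM : 1 / δ ≤ M) :
    ∃ χ : ZMod M → ℝ, 0 ≤ χ ∧ (∀ x ∈ zmodInterval N M, χ x = 1) ∧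
      (𝔼 x, χ x) - (zmodInterval N M).dens ≤ 4 * δ ∧
      ∃ κ ≥ δ, (κ ^ 2) • χ ∈ dualHull (Fin 2) (ZMod M) := by
  have M_pos : (0 : ℝ) < M := Nat.cast_pos.2 (NeZero.pos M)
  have one_le : 1 ≤ δ * M := (div_le_iff₀' hδ).1 hM
  set m := ⌈δ * M⌉₊
  have le_m : δ * M ≤ m := Nat.le_ceil _
  have m_lt : (m : ℝ) < δ * M + 1 := Nat.ceil_lt_add_one (by positivity)
  have m_pos : 0 < m := Nat.ceil_pos.2 (by positivity)
  have m_le : m ≤ M := Nat.ceil_le.2 (mul_le_of_le_one_left M_pos.le hδ1)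
  set A : Finset (ZMod M) := (Finset.Ico (0 : ℤ) m).image Int.cast
  set B : Finset (ZMod M) := (Finset.Ico (-N : ℤ) (2 * m)).image Int.cast
  have A_nonempty : A.Nonempty := (Finset.nonempty_Ico.2 (by exact_mod_cast m_pos)).image _
  have dens_A : (A.dens : ℝ) = m / M := by
    rw [dens_image_intCast (Finset.Ico_subset_Ico_right (by exact_mod_cast m_le))]
    simp
  have dens_B : (B.dens : ℝ) ≤ (2 * m + N) / M := by
    refine (dens_image_intCast_le _).trans_eq (congrArg (· / _) ?_)
    rw [Int.card_Ico, show (2 * m - -N : ℤ).toNat = 2 * m + N by omega]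
    push_cast
    rfl
  refine ⟨cutoff A B, cutoff_nonneg, fun x hx => cutoff_eq_one A_nonempty ?_, ?_, A.dens, ?_,
    smul_cutoff_mem_dualHull⟩
  · obtain ⟨n, hn, rfl⟩ := Finset.mem_image.1 hx
    refine Finset.forall_mem_image.2 fun a ha => Finset.forall_mem_image.2 fun b hb => ?_
    rw [Finset.mem_Icc] at hn
    rw [Finset.mem_Ico] at ha hb
    exact Finset.mem_image.2 ⟨a + b - n, Finset.mem_Ico.2 (by omega), by push_cast; rfl⟩
  · rw [expect_cutoff A_nonempty, dens_zmodInterval hNM]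
    calc (B.dens : ℝ) - N / M ≤ (2 * m + N) / M - N / M := by gcongr
      _ = 2 * m / M := by ring
      _ ≤ 4 * δ := (div_le_iff₀ M_pos).2 (by linarith)
  · rw [dens_A]
    exact (le_div_iff₀ M_pos).2 le_m

theorem eventually_isDualSmall_sub_indicator {κ : Type*} [Fintype κ] [DecidableEq κ] {ε : ℝ}
    (hε : 0 < ε) :
    ∀ᶠ δ in 𝓝[>] (0 : ℝ), ∀ᶠ M : ℕ in atTop, ∀ [NeZero M] (N : ℕ), N < M → ∀ f g : ZMod M → ℝ,
      IsDualSmall (Fin 2 ⊕ κ) δ (f - g) → (∀ x ∉ zmodInterval N M, f x = 0) → (∀ x, |g x| ≤ 1) →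
      IsDualSmall (Fin 2 ⊕ κ) ε (f - Set.indicator (zmodInterval N M) g) := by
  obtain ⟨γ, γ_pos, γ_le⟩ : ∃ γ : ℝ, 0 < γ ∧ γ ≤ 1 ∧ γ ≤ ε / 8 :=
    ⟨min 1 (ε / 8), by positivity, min_le_left _ _, min_le_right _ _⟩
  filter_upwards [eventually_mul_le (γ ^ 2)⁻¹ (half_pos hε), self_mem_nhdsWithin] with δ hδ δ_pos
  filter_upwards [eventually_ge_atTop ⌈1 / γ⌉₊] with M hM _ N hNM f g hfg hf hg
  obtain ⟨χ, χ_nonneg, χ_one, expect_χ, α, hα, hχ⟩ :=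
    exists_cutoff_zmodInterval hNM γ_pos γ_le.1 (Nat.ceil_le.1 hM)
  refine (hfg.sub_indicator hf hg (pow_pos (γ_pos.trans_le hα) 2)
    (dualHull_subset_dualHull_sum hχ) χ_nonneg χ_one).mono ?_
  have : (α ^ 2)⁻¹ * δ ≤ (γ ^ 2)⁻¹ * δ := by
    gcongr
    exact (Set.mem_Ioi.1 δ_pos).le
  linarith

end IntervalCutoff

section FreimanInvariance

variable {ι Z Z' : Type*} [Fintype ι] [AddCommGroup Z] [AddCommGroup Z'] {φ : Z → Z'} {ψ : Z' → Z}
  {A : Set Z} {B : Set Z'}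

/-- The parallelepiped spanned by the images under `φ` of the base point and its neighbours. -/
def mapCube (φ : Z → Z') (p : Z × (ι → Z)) : Z' × (ι → Z') :=
  (φ p.1, fun i => φ (p.1 + p.2 i) - φ p.1)

/-- The set of parallelepipeds all of whose vertices lie in `A`. -/
def cubesIn (ι : Type*) [Fintype ι] (A : Set Z) : Set (Z × (ι → Z)) :=
  {p | ∀ ω, cubeVertex p.1 p.2 ω ∈ A}

theorem cubeVertex_single [DecidableEq ι] (x : Z) (h : ι → Z) (i : ι) :
    cubeVertex x h (Pi.single i 1) = x + h i := by
  rw [cubeVertex, Fintype.sum_eq_single i fun j hj => by simp [hj]]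
  simp

theorem cubeVertex_piecewise_zero [DecidableEq ι] (x : Z) (h : ι → Z) (S : Finset ι)
    (ω : ι → Fin 2) : cubeVertex x h (S.piecewise ω 0) = x + ∑ i ∈ S, (ω i : ℕ) • h i := by
  simp only [cubeVertex, Finset.piecewise, Pi.zero_apply, apply_ite Fin.val, ite_smul,
    Fin.val_zero, zero_smul, Finset.sum_ite_mem, Finset.univ_inter]

theorem fst_mem_of_mem_cubesIn {p : Z × (ι → Z)} (hp : p ∈ cubesIn ι A) : p.1 ∈ A := by
  simpa using hp 0

theorem add_mem_of_mem_cubesIn {p : Z × (ι → Z)} (hp : p ∈ cubesIn ι A) (i : ι) :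
    p.1 + p.2 i ∈ A := by
  classical
  simpa only [cubeVertex_single] using hp (Pi.single i 1)

theorem cubeVertex_mapCube (hφ : IsAddFreimanHom 2 A B φ) {p : Z × (ι → Z)}
    (hp : p ∈ cubesIn ι A) (ω : ι → Fin 2) :
    cubeVertex (mapCube φ p).1 (mapCube φ p).2 ω = φ (cubeVertex p.1 p.2 ω) := by
  classical
  have partial_mem (S : Finset ι) : p.1 + ∑ i ∈ S, (ω i : ℕ) • p.2 i ∈ A := by
    rw [← cubeVertex_piecewise_zero]
    exact hp _
  suffices h : ∀ S : Finset ι, φ (p.1 + ∑ i ∈ S, (ω i : ℕ) • p.2 i) =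
      φ p.1 + ∑ i ∈ S, (ω i : ℕ) • (φ (p.1 + p.2 i) - φ p.1) from (h Finset.univ).symm
  intro S
  induction S using Finset.induction_on with
  | empty => simp
  | insert j S hj ih =>
    have mem := partial_mem (insert j S)
    have fin_two : ∀ b : Fin 2, b = 0 ∨ b = 1 := by decide
    rw [Finset.sum_insert hj] at mem ⊢
    rw [Finset.sum_insert hj]
    rcases fin_two (ω j) with hω | hω <;>
      simp only [hω, Fin.val_zero, Fin.val_one, zero_smul, one_smul, zero_add] at mem ⊢
    · exact ih
    · have h := hφ.add_eq_add mem (fst_mem_of_mem_cubesIn hp) (partial_mem S)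
        (add_mem_of_mem_cubesIn hp j) (by abel)
      rw [ih] at h
      rw [eq_sub_of_add_eq h]
      abel

theorem mapCube_mapCube (hψ : Set.LeftInvOn ψ φ A) {p : Z × (ι → Z)} (hp : p ∈ cubesIn ι A) :
    mapCube ψ (mapCube φ p) = p := by
  refine Prod.ext (hψ (fst_mem_of_mem_cubesIn hp)) (funext fun i => ?_)
  simp only [mapCube, add_sub_cancel, hψ (fst_mem_of_mem_cubesIn hp),
    hψ (add_mem_of_mem_cubesIn hp i), add_sub_cancel_left]

theorem mapCube_mem_cubesIn (hφ : IsAddFreimanHom 2 A B φ) {p : Z × (ι → Z)}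
    (hp : p ∈ cubesIn ι A) : mapCube φ p ∈ cubesIn ι B := fun ω => by
  rw [cubeVertex_mapCube hφ hp]
  exact hφ.mapsTo (hp ω)

variable [DecidableEq ι] [Fintype Z] [Fintype Z']

open Classical in
theorem card_mul_cubeAvg_eq_sum {f : Z → ℝ} (hf : ∀ x ∉ A, f x = 0) :
    (Fintype.card Z : ℝ) ^ (Fintype.card ι + 1) * cubeAvg (fun _ : ι → Fin 2 => f) =
      ∑ p with p ∈ cubesIn ι A, ∏ ω, f (cubeVertex p.1 p.2 ω) := by
  have card_cubes : (Fintype.card Z : ℝ) ^ (Fintype.card ι + 1) =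
      Fintype.card (Z × (ι → Z)) := by
    simp [pow_succ']
  rw [card_cubes, cubeAvg_eq_expect_prod, Fintype.card_mul_expect]
  refine (Finset.sum_filter_of_ne fun p _ hp ω => ?_).symm
  by_contra hω
  exact hp (Finset.prod_eq_zero (Finset.mem_univ ω) (hf _ hω))

theorem card_mul_cubeAvg_eq_of_isAddFreimanIso (hφ : IsAddFreimanIso 2 A B φ) {f : Z → ℝ}
    {g : Z' → ℝ} (hf : ∀ x ∉ A, f x = 0) (hg : ∀ y ∉ B, g y = 0) (hfg : ∀ x ∈ A, g (φ x) = f x) :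
    (Fintype.card Z : ℝ) ^ (Fintype.card ι + 1) * cubeAvg (fun _ : ι → Fin 2 => f) =
      (Fintype.card Z' : ℝ) ^ (Fintype.card ι + 1) * cubeAvg (fun _ : ι → Fin 2 => g) := by
  classical
  have inv := hφ.bijOn.invOn_invFunOn
  rw [card_mul_cubeAvg_eq_sum hf, card_mul_cubeAvg_eq_sum hg]
  refine Finset.sum_nbij' (mapCube φ) (mapCube (φ.invFunOn A)) ?_ ?_ ?_ ?_ ?_ <;>
    simp only [Finset.mem_filter_univ]
  · exact fun p => mapCube_mem_cubesIn hφ.isAddFreimanHom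
  · exact fun p => mapCube_mem_cubesIn hφ.invFunOn.isAddFreimanHom
  · exact fun p => mapCube_mapCube inv.1
  · exact fun p => mapCube_mapCube inv.2
  · intro p hp
    refine Finset.prod_congr rfl fun ω _ => ?_
    rw [cubeVertex_mapCube hφ.isAddFreimanHom hp, hfg _ (hp ω)]

theorem cubeNorm_eq_of_isAddFreimanIso [Nonempty ι] (hφ : IsAddFreimanIso 2 A B φ) {f : Z → ℝ}
    {g : Z' → ℝ} (hf : ∀ x ∉ A, f x = 0) (hg : ∀ y ∉ B, g y = 0) (hfg : ∀ x ∈ A, g (φ x) = f x) :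
    cubeNorm ι f =
      ((Fintype.card Z' / Fintype.card Z : ℝ) ^ (Fintype.card ι + 1)) ^
        (1 / (2 : ℝ) ^ Fintype.card ι) * cubeNorm ι g := by
  have card_pos : 0 < (Fintype.card Z : ℝ) ^ (Fintype.card ι + 1) := by positivity
  rw [cubeNorm, cubeNorm, ← Real.mul_rpow (by positivity) (cubeAvg_const_nonneg g), div_pow,
    div_mul_eq_mul_div, ← card_mul_cubeAvg_eq_of_isAddFreimanIso hφ hf hg hfg,
    mul_div_cancel_left₀ _ card_pos.ne']

end FreimanInvariance

section Interval

variable {M M' N : ℕ}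

theorem isAddFreimanIso_intCast_zmodInterval (hM : 2 * N < M) :
    IsAddFreimanIso 2 (Set.Icc (1 : ℤ) N) (zmodInterval N M) (Int.cast : ℤ → ZMod M) := by
  have cast_inj {a b : ℤ} (hab : |b - a| < M) : (a : ZMod M) = b ↔ a = b := by
    refine ⟨fun h => ?_, congrArg _⟩
    linarith [Int.eq_zero_of_abs_lt_dvd ((ZMod.intCast_eq_intCast_iff_dvd_sub a b M).1 h) hab]
  refine isAddFreimanIso_two.2 ⟨⟨?_, ?_, ?_⟩, fun a ha b hb c hc d hd => ?_⟩
  · exact fun z hz => Finset.mem_coe.2 (Finset.mem_image_of_mem _ (Finset.mem_Icc.2 hz))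
  · intro a ha b hb hab
    rw [Set.mem_Icc] at ha hb
    exact (cast_inj (abs_lt.2 (by omega))).1 hab
  · intro x hx
    simpa [zmodInterval] using hx
  · rw [Set.mem_Icc] at ha hb hc hd
    exact_mod_cast cast_inj (abs_lt.2 (by omega))

variable [NeZero M]

theorem isAddFreimanIso_zmodInterval (hM : 2 * N < M) (hM' : 2 * N < M') :
    IsAddFreimanIso 2 (zmodInterval N M : Set (ZMod M)) (zmodInterval N M')
      (fun x => ((x.val : ℤ) : ZMod M')) := by
  refine (isAddFreimanIso_intCast_zmodInterval hM').comp
    ((isAddFreimanIso_intCast_zmodInterval hM).symm (g := fun x => (x.val : ℤ)) (fun x hx => ?_)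
      fun x _ => by simp)
  have := Finset.mem_Icc.1 ((mem_zmodInterval (by omega)).1 hx)
  exact Set.mem_Icc.2 (show 1 ≤ (x.val : ℤ) ∧ (x.val : ℤ) ≤ N by omega)

theorem extendInterval_of_notMem (hNM : N < M) (f : Finset.Icc 1 N → ℝ) {x : ZMod M}
    (hx : x ∉ zmodInterval N M) : extendInterval M f x = 0 :=
  dif_neg (mt (mem_zmodInterval hNM).2 hx)

theorem extendInterval_apply_val (hM : 2 * N < M) (hM' : 2 * N < M') (f : Finset.Icc 1 N → ℝ)
    {x : ZMod M} (hx : x ∈ zmodInterval N M) :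
    extendInterval M' f (x.val : ZMod M') = extendInterval M f x := by
  have hx' := (mem_zmodInterval (by omega)).1 hx
  have val_cast : (x.val : ZMod M').val = x.val :=
    ZMod.val_cast_of_lt (by rw [Finset.mem_Icc] at hx'; omega)
  simp only [extendInterval, val_cast]

theorem gowersIntervalNorm_eq [NeZero M'] (hM : 2 * N < M) (hM' : 2 * N < M') (s : ℕ) [NeZero s]
    (f : Finset.Icc 1 N → ℝ) : gowersIntervalNorm M s f = gowersIntervalNorm M' s f := by
  have cubeNorm_extendInterval (g : Finset.Icc 1 N → ℝ) :=
    cubeNorm_eq_of_isAddFreimanIso (ι := Fin s) (isAddFreimanIso_zmodInterval hM hM')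
      (fun x => extendInterval_of_notMem (by omega) g)
      (fun x => extendInterval_of_notMem (by omega) g)
      (fun x hx => by simpa using extendInterval_apply_val hM hM' g hx)
  simp only [gowersIntervalNorm, gowersNorm_eq_cubeNorm, cubeNorm_extendInterval]
  exact mul_div_mul_left _ _ (by positivity)

end Interval

section Transference

open Filter
open scoped Topology

theorem extendInterval_sub (M : ℕ) {N : ℕ} (f g : Finset.Icc 1 N → ℝ) :
    extendInterval M (fun n => f n - g n) = extendInterval M f - extendInterval M g := by
  funext x
  simp only [extendInterval, Pi.sub_apply]
  split_ifs <;> simp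

theorem extendInterval_restrict {M N : ℕ} [NeZero M] (hNM : N < M) (g : ZMod M → ℝ) :
    extendInterval M (fun n : Finset.Icc 1 N => g (n : ℕ)) =
      Set.indicator (zmodInterval N M) g := by
  classical
  funext x
  simp only [extendInterval, Set.indicator_apply, Finset.mem_coe, mem_zmodInterval hNM,
    ZMod.natCast_val, ZMod.cast_id', id_eq, dite_eq_ite]

theorem abs_extendInterval_le {M N : ℕ} [NeZero M] {f : Finset.Icc 1 N → ℝ} {ν : ZMod M → ℝ}
    (hν : ∀ x, 0 ≤ ν x) (hf : ∀ n, |f n| ≤ ν (n : ℕ)) (x : ZMod M) :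
    |extendInterval M f x| ≤ ν x := by
  unfold extendInterval
  split_ifs with hx
  · simpa using hf ⟨x.val, hx⟩
  · simpa using hν x

theorem gowersIntervalNorm_le {M N s : ℕ} [NeZero M] [NeZero s] {D : ℝ} (hD : 0 < D)
    (hNM : N < M) (hMD : M ≤ D * N) (f : Finset.Icc 1 N → ℝ) :
    gowersIntervalNorm M s f ≤ D * gowersNorm s (extendInterval M f) := by
  have M_pos : (0 : ℝ) < M := Nat.cast_pos.2 (NeZero.pos M)
  have le_norm_one : D⁻¹ ≤ gowersNorm s (extendInterval M fun _ : Finset.Icc 1 N => (1 : ℝ)) :=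
    calc D⁻¹ ≤ N / M := by
          rw [le_div_iff₀ M_pos, inv_mul_le_iff₀ hD]
          exact hMD
      _ = 𝔼 x : ZMod M, extendInterval M (fun _ : Finset.Icc 1 N => (1 : ℝ)) x := by
          rw [← dens_zmodInterval hNM, ← Finset.expect_indicator_one]
          exact congrArg _ (extendInterval_restrict hNM 1).symm
      _ ≤ _ := by
          rw [gowersNorm_eq_cubeNorm]
          exact (le_abs_self _).trans (abs_expect_le_cubeNorm _)
  have norm_nonneg : 0 ≤ gowersNorm s (extendInterval M f) := by
    rw [gowersNorm_eq_cubeNorm]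
    exact cubeNorm_nonneg _
  rw [gowersIntervalNorm, mul_comm]
  simpa only [div_inv_eq_mul] using div_le_div_of_nonneg_left norm_nonneg (inv_pos.2 hD) le_norm_one

theorem eventually_exists_cubeNorm_sub_indicator_le {κ : Type*} [Fintype κ] [DecidableEq κ] {ε : ℝ}
    (hε : 0 < ε) :
    ∀ᶠ δ in 𝓝[>] (0 : ℝ), ∀ᶠ M : ℕ in atTop, ∀ [NeZero M] (N : ℕ), N < M → ∀ ν f : ZMod M → ℝ,
      cubeNorm ((Fin 2 ⊕ κ) ⊕ (Fin 2 ⊕ κ)) (ν - 1) ≤ δ → (∀ x, |f x| ≤ ν x) →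
      (∀ x ∉ zmodInterval N M, f x = 0) →
      ∃ g : ZMod M → ℝ, (∀ x, |g x| ≤ 1) ∧ (0 ≤ f → 0 ≤ g) ∧
        cubeNorm (Fin 2 ⊕ κ) (f - Set.indicator (zmodInterval N M) g) ≤ ε := by
  obtain ⟨δ₁, cubeNorm_le, δ₁_pos⟩ :=
    ((eventually_cubeNorm_sub_le (ι := Fin 2 ⊕ κ) hε).and self_mem_nhdsWithin).exists
  obtain ⟨δ₂, localise, δ₂_pos⟩ :=
    ((eventually_isDualSmall_sub_indicator (κ := κ) δ₁_pos).and self_mem_nhdsWithin).exists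
  filter_upwards [eventually_exists_isDualSmall_sub (ι := Fin 2 ⊕ κ) δ₂_pos, Ioc_mem_nhdsGT δ₁_pos]
    with δ dense_model hδ
  filter_upwards [localise] with M localise _ N hNM ν f hν hfν hf
  obtain ⟨g, hg, g_nonneg, hfg⟩ := dense_model (ZMod M) ν f (.of_cubeNorm_sum_le hν) hfν
  refine ⟨g, hg, g_nonneg, cubeNorm_le (ZMod M) ν f _ (hν.trans hδ.2) hfν (fun x => ?_)
    (localise N hNM f g hfg hf hg)⟩
  classical
  rw [Set.indicator_apply]
  split_ifs <;> simp [hg]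

end Transference

theorem corollary5p5_general (s : ℕ) (hs : 2 ≤ s) {D : ℝ} (hD : 0 < D) {ε : ℝ} (hε : 0 < ε) :
    ∃ N₀ : ℕ, 0 < N₀ ∧ ∃ η : ℝ, 0 < η ∧
      ∀ N : ℕ, N₀ ≤ N →
      ∀ (N' : ℕ) [NeZero N'], 2 * N < N' → (N' : ℝ) ≤ D * N →
      ∀ ν : ZMod N' → ℝ, (∀ x, 0 ≤ ν x) →
        gowersNorm (2 * s) (fun x => ν x - 1) ≤ η →
      ∀ f : Finset.Icc 1 N → ℝ, (∀ n : Finset.Icc 1 N, |f n| ≤ ν ((n : ℕ) : ZMod N')) →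
      ∃ h : Finset.Icc 1 N → ℝ,
        (∀ n, h n ∈ Set.Icc (-1 : ℝ) 1) ∧
        (∀ (M : ℕ) [NeZero M], 2 * N < M →
          gowersIntervalNorm M s (fun n => f n - h n) ≤ ε) ∧
        ((∀ n, 0 ≤ f n) → ∀ n, 0 ≤ h n) := by
  obtain ⟨k, rfl⟩ := Nat.exists_eq_add_of_le hs
  have : NeZero (2 + k) := ⟨by omega⟩
  obtain ⟨η, model, η_pos⟩ := ((eventually_exists_cubeNorm_sub_indicator_le (κ := Fin k)
    (div_pos hε hD)).and self_mem_nhdsWithin).exists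
  obtain ⟨N₁, hN₁⟩ := Filter.eventually_atTop.1 model
  refine ⟨N₁ + 1, N₁.succ_pos, η, η_pos, fun N hN N' _ hNN' hND ν hν hνη f hf => ?_⟩
  have e : Fin (2 * (2 + k)) ≃ (Fin 2 ⊕ Fin k) ⊕ (Fin 2 ⊕ Fin k) :=
    Fintype.equivOfCardEq (by simp [two_mul])
  rw [gowersNorm_eq_cubeNorm, cubeNorm_congr e] at hνη
  obtain ⟨g, hg, g_nonneg, hfg⟩ := hN₁ N' (by omega) N (by omega) ν (extendInterval N' f) hνη
    (abs_extendInterval_le hν hf) fun _ => extendInterval_of_notMem (by omega) f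
  refine ⟨fun n => g (n : ℕ), fun n => abs_le.1 (hg _), fun M _ hM => ?_, fun hf n => g_nonneg ?_ _⟩
  · rw [gowersIntervalNorm_eq hM hNN']
    refine (gowersIntervalNorm_le hD (by omega) hND _).trans ((le_div_iff₀' hD).1 ?_)
    rwa [extendInterval_sub, extendInterval_restrict (by omega), gowersNorm_eq_cubeNorm,
      cubeNorm_congr finSumFinEquiv.symm]
  · intro x
    unfold extendInterval
    split_ifs
    exacts [hf _, le_rfl]

theorem corollary5p5 (s : ℕ) (hs : 2 ≤ s) (C : ℝ) (hC : 20 ≤ C)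
    (ε : ℝ) (hε : 0 < ε) (hε1 : ε ≤ 1) :
    ∃ N₀ : ℕ, 0 < N₀ ∧ ∃ η : ℝ, 0 < η ∧
      ∀ N : ℕ, N₀ ≤ N →
      ∀ (N' : ℕ) [Fact N'.Prime], C * (N : ℝ) ≤ (N' : ℝ) → (N' : ℝ) ≤ 2 * C * (N : ℝ) →
      ∀ ν : ZMod N' → ℝ, (∀ x, 0 ≤ ν x) →
        gowersNorm (2 * s) (fun x => ν x - 1) ≤ η →
      ∀ f : Finset.Icc 1 N → ℝ, (∀ n : Finset.Icc 1 N, |f n| ≤ ν ((n : ℕ) : ZMod N')) →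
      ∃ h : Finset.Icc 1 N → ℝ,
        (∀ n, h n ∈ Set.Icc (-1 : ℝ) 1) ∧
        (∀ (M : ℕ) [NeZero M], 2 * N < M →
          gowersIntervalNorm M s (fun n => f n - h n) ≤ ε) ∧
        ((∀ n, 0 ≤ f n) → ∀ n, 0 ≤ h n) := by
  obtain ⟨N₀, hN₀, η, hη, model⟩ := corollary5p5_general s hs (D := 2 * C) (by linarith) hε
  refine ⟨N₀, hN₀, η, hη, fun N hN N' _ hCN hNC => model N hN N' ?_ hNC⟩
  have N_pos : (0 : ℝ) < N := Nat.cast_pos.2 (by omega)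
  have : (2 * N : ℝ) < N' := (mul_lt_mul_of_pos_right (by linarith) N_pos).trans_le hCN
  exact_mod_cast this
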